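/- All $2$-categories, $2$-functors and $2$-natural transformations are strict, and $\mathbf{CAT}$ is the $2$-category of categories. **Lax slice.** For a $2$-category $\mathcal E$ and $M\in\mathcal E$, the lax slice $\mathcal E/\!/M$ has as objects the $1$-cells $g\colon E\to M$, as $1$-cells from $g\colon E\to M$ to $g'\colon E'\to M$ the pairs $(h,\gamma)$ with $h\colon E\to E'$ and $\gamma\colon g\Rightarrow g'\circ h$, and as $2$-cells $(h,\gamma)\Rightarrow(k,\kappa)$ the $2$-cells $\delta\colon h\Rightarrow k$ of $\mathcal E$ with $(g'\ast\delta)\circ\gamma=\kappa$. The $2$-functor $\operatorname{dom}\colon\mathcal E/\!/M\to\mathcal E$ sends $g$, $(h,\gamma)$, $\delta$ to $E$, $h$, $\delta$. **Grothendieck construction.** For a $2$-functor $W\colon\mathcal A^{\mathrm{op}}\to\mathbf{CAT}$, the $2$-category $\int W$ has as objects the pairs $(A,X)$ with $A\in\mathcal A$, $X\in W(A)$; as $1$-cells $(A,X)\to(B,X')$ the pairs $(f,\alpha)$ with $f\colon A\to B$ and $\alpha\colon X\to W(f)(X')$; as $2$-cells $(f,\alpha)\Rightarrow(g,\beta)$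 the $2$-cells $\delta\colon f\Rightarrow g$ of $\mathcal A$ with $W(\delta)_{X'}\circ\alpha=\beta$. Let $\mathcal G(W)\colon\int W\to\mathcal A$ be the projection. **Oplax normal colimits.** An oplax normal $2$-cocone $\theta$ for a $2$-functor $D\colon\int W\to\mathcal E$ on $C\in\mathcal E$ consists of $1$-cells $\theta_{(A,X)}\colon D(A,X)\to C$ and $2$-cells $\theta_{f,\alpha}\colon\theta_{(A,X)}\Rightarrow\theta_{(B,X')}\circ D(f,\alpha)$, compatible with identities, with composition of $1$-cells and with $2$-cells (that is, an oplax natural transformation $\Delta 1\to\mathcal E(D(-),C)$), such that $\theta_{f,\mathrm{id}}$ is an identity for every $1$-cell $(f,\mathrm{id})\colon (A,W(f)(X'))\to(B,X')$. With modifications they form a category; $\theta$ is *universal*, exhibiting $C$ as the oplax normal conical colimit of $D$, if for every $U\in\mathcal E$ postcomposition with $\theta$ is an isomorphism of categories from $\mathcal E(C,U)$ to the category of oplax normal $2$-cocones for $D$ on $U$. **Fibrations.** A $2$-functor $p\colon\mathcal S\to\mathcal E$ is a *$2$-Set-fibration* if its underlying functor is a Grothendieck fibration and every functor $\mathcal S(x,y)\to\mathcal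 E(p(x),p(y))$ is a discrete opfibration; it is *cloven* if it is equipped with a cleavage, i.e. a choice of a cartesian lifting to $s$ of each $1$-cell $e\to p(s)$. Given a cleavage, $s\in\mathcal S$, $D\colon\int W\to\mathcal E$ and an oplax normal $2$-cocone $\theta$ for $D$ on $p(s)$, a *lifting of $(D,\theta)$ to $s$* is a pair $(\overline D,\overline\theta)$ of a $2$-functor $\overline D\colon\int W\to\mathcal S$ and an oplax normal $2$-cocone $\overline\theta$ for $\overline D$ on $s$ with $p\circ\overline D=D$, $p\circ\overline\theta=\theta$, such that each $\overline\theta_{(A,X)}$ is the chosen cartesian lifting of $\theta_{(A,X)}$ to $s$. A cloven $2$-Set-fibration $p$ is a *$2$-colim-fibration* if, for all $s\in\mathcal S$, all $W\colon\mathcal A^{\mathrm{op}}\to\mathbf{CAT}$, all $D\colon\int W\to\mathcal E$ and every universal oplax normal $2$-cocone $\theta$ for $D$ on $p(s)$, the lifting of $(D,\theta)$ to $s$ (which exists and is unique) is again universal. **Theorem.** Let $\mathcal E$ be a $2$-category and $M\in\mathcal E$. 1. $\operatorname{dom}\colon\mathcal E/\!/M\to\mathcal E$ has a canonical cleavage,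 in which the chosen lifting of $f\colon E\to E'$ to $g\colon E'\to M$ is $(f,\mathrm{id})\colon g\circ f\to g$; and, with this or any other cleavage, $\operatorname{dom}$ is a $2$-colim-fibration (in particular the liftings of universal oplax normal $2$-cocones exist and are unique). 2. Consequently, let $W\colon\mathcal A^{\mathrm{op}}\to\mathbf{CAT}$ and $F\colon\mathcal A\to\mathcal E$ be $2$-functors and let the $2$-natural transformation $\mu\colon W\Rightarrow\mathcal E(F(-),C)$ exhibit $C=W\ast F$ as the colimit of $F$ weighted by $W$ (postcomposition with $\mu$ is, for every $U$, an isomorphism from $\mathcal E(C,U)$ to the category of $2$-natural transformations $W\Rightarrow\mathcal E(F(-),U)$ and modifications). Let $\theta$ be the corresponding oplax normal $2$-cocone for $F\circ\mathcal G(W)$ on $C$, given by $\theta_{(A,X)}=\mu_A(X)$ and $\theta_{f,\alpha}=\mu_A(\alpha)$. Then $\theta$ is universal, so $C$ is the oplax normal conical colimit of $F\circ\mathcal G(W)$. For every $q\colon C\to M$ let $\lambda^q$ be the oplax normal $2$-cocone on $M$ that corresponds in the same way to $\nu^q=\mathcal E(F(-),q)\circ\mu$, and let $L^q\colon\int W\to\mathcal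 E/\!/M$ be the $2$-functor given by $L^q(A,X)=\lambda^q_{(A,X)}\colon F(A)\to M$, $L^q(f,\alpha)=(F(f),\lambda^q_{f,\alpha})$ and $L^q(\delta)=F(\delta)$. Then $q$ is the oplax normal conical colimit of $L^q$ in $\mathcal E/\!/M$, exhibited by the oplax normal $2$-cocone for $L^q$ on $q$ that, together with $L^q$, is the lifting of $(F\circ\mathcal G(W),\theta)$ to $q$ through $\operatorname{dom}$ with its canonical cleavage (so its components are $(\theta_{(A,X)},\mathrm{id})$ and its structure $2$-cells are $\theta_{f,\alpha}$). -/

import Mathlib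

open CategoryTheory Bicategory Opposite Bicategory.Opposite

universe w v u w₁ v₁ u₁ v₂ u₂ w₃ v₃ u₃

namespace TwoColim

section LaxSlice

variable {E : Type u} [Bicategory.{w, v} E]

/-- Objects of the lax slice `E // M`: 1-cells with codomain `M`. -/
structure LaxSlice (M : E) where
  left : E
  hom : left ⟶ M

namespace LaxSlice

variable {M : E}

/-- A 1-cell of the lax slice from `g` to `g'`: a 1-cell `h` between the domains together with
a 2-cell from `g` to the composite of `h` followed by `g'`. -/
structure Hom (X Y : LaxSlice M) where
  left : X.left ⟶ Y.left
  cell : X.hom ⟶ left ≫ Y.hom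

instance : Quiver (LaxSlice M) where
  Hom := Hom

/-- A 2-cell of the lax slice: a 2-cell of `E` compatible with the filling 2-cells. -/
@[ext]
structure Hom₂ {X Y : LaxSlice M} (f g : X ⟶ Y) where
  left : f.left ⟶ g.left
  w : f.cell ≫ left ▷ Y.hom = g.cell

instance : CategoryStruct (LaxSlice M) where
  id X := ⟨𝟙 X.left, (λ_ X.hom).inv⟩
  comp {_ _ Z} f g := ⟨f.left ≫ g.left, f.cell ≫ f.left ◁ g.cell ≫ (α_ f.left g.left Z.hom).inv⟩

instance homCategory (X Y : LaxSlice M) : Category (X ⟶ Y) where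
  Hom := Hom₂
  id f := ⟨𝟙 f.left, by simp⟩
  comp {f g h} η θ := ⟨η.left ≫ θ.left, by
    rw [comp_whiskerRight, ← Category.assoc, η.w, θ.w]⟩
  id_comp η := Hom₂.ext (Category.id_comp _)
  comp_id η := Hom₂.ext (Category.comp_id _)
  assoc η θ κ := Hom₂.ext (Category.assoc _ _ _)

@[simp] lemma id_left (X : LaxSlice M) : Hom.left (𝟙 X) = 𝟙 X.left := rfl
@[simp] lemma id_cell (X : LaxSlice M) : Hom.cell (𝟙 X) = (λ_ X.hom).inv := rfl
@[simp] lemma comp_left {X Y Z : LaxSlice M} (f : X ⟶ Y) (g : Y ⟶ Z) :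
    Hom.left (f ≫ g) = f.left ≫ g.left := rfl
@[simp] lemma comp_cell {X Y Z : LaxSlice M} (f : X ⟶ Y) (g : Y ⟶ Z) :
    Hom.cell (f ≫ g) = f.cell ≫ f.left ◁ g.cell ≫ (α_ f.left g.left Z.hom).inv := rfl
@[simp] lemma id₂_left {X Y : LaxSlice M} (f : X ⟶ Y) : Hom₂.left (𝟙 f) = 𝟙 f.left := rfl
@[simp] lemma comp₂_left {X Y : LaxSlice M} {f g h : X ⟶ Y} (η : f ⟶ g) (θ : g ⟶ h) :
    Hom₂.left (η ≫ θ) = η.left ≫ θ.left := rfl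

@[ext]
lemma hom₂_ext {X Y : LaxSlice M} {f g : X ⟶ Y} {η θ : f ⟶ g} (h : η.left = θ.left) : η = θ :=
  Hom₂.ext h

/-- Build an invertible 2-cell of the lax slice from one in `E`. -/
@[simps]
def isoMk {X Y : LaxSlice M} {f g : X ⟶ Y} (e : f.left ≅ g.left)
    (w : f.cell ≫ e.hom ▷ Y.hom = g.cell) : f ≅ g where
  hom := ⟨e.hom, w⟩
  inv := ⟨e.inv, by rw [← w]; simp⟩
  hom_inv_id := by ext; simp
  inv_hom_id := by ext; simp

instance bicategory : Bicategory (LaxSlice M) where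
  homCategory := homCategory
  whiskerLeft f _ _ η := ⟨f.left ◁ η.left, by
    simp [← η.w]⟩
  whiskerRight {_ _ _ f g} η h := ⟨η.left ▷ h.left, by
    simp only [comp_cell, comp_left, Category.assoc, ← η.w,
      ← associator_inv_naturality_left, ← whisker_exchange_assoc]⟩
  associator f g h := isoMk (α_ f.left g.left h.left) (by simp)
  leftUnitor f := isoMk (λ_ f.left) (by simp)
  rightUnitor f := isoMk (ρ_ f.left) (by simp)
  whisker_exchange η θ := by ext; exact whisker_exchange _ _

@[simp] lemma whiskerLeft_left {X Y Z : LaxSlice M} (f : X ⟶ Y) {g h : Y ⟶ Z} (η : g ⟶ h) :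
    Hom₂.left (f ◁ η) = f.left ◁ η.left := rfl
@[simp] lemma whiskerRight_left {X Y Z : LaxSlice M} {f g : X ⟶ Y} (η : f ⟶ g) (h : Y ⟶ Z) :
    Hom₂.left (η ▷ h) = η.left ▷ h.left := rfl

lemma hom_eq {X Y : LaxSlice M} {f g : X ⟶ Y} (η : f ⟶ g) (h : f.left = g.left)
    (hη : η.left = eqToHom h) : f = g := by
  obtain ⟨f, γ⟩ := f
  obtain ⟨g, γ'⟩ := g
  obtain ⟨η, w⟩ := η
  dsimp at h hη w
  subst h hη
  simp at w
  rw [w]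

@[simp] lemma eqToHom_left {X Y : LaxSlice M} {f g : X ⟶ Y} (h : f = g) :
    Hom₂.left (eqToHom h) = eqToHom (congrArg Hom.left h) := by
  subst h; rfl

instance strict [Strict E] : Strict (LaxSlice M) where
  id_comp f := hom_eq (λ_ f).hom (Strict.id_comp _)
    (congrArg Iso.hom (Strict.leftUnitor_eqToIso f.left))
  comp_id f := hom_eq (ρ_ f).hom (Strict.comp_id _)
    (congrArg Iso.hom (Strict.rightUnitor_eqToIso f.left))
  assoc f g h := hom_eq (α_ f g h).hom (Strict.assoc _ _ _)
    (congrArg Iso.hom (Strict.associator_eqToIso f.left g.left h.left))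
  leftUnitor_eqToIso f := by
    ext
    exact (congrArg Iso.hom (Strict.leftUnitor_eqToIso f.left)).trans (by simp)
  rightUnitor_eqToIso f := by
    ext
    exact (congrArg Iso.hom (Strict.rightUnitor_eqToIso f.left)).trans (by simp)
  associator_eqToIso f g h := by
    ext
    exact (congrArg Iso.hom (Strict.associator_eqToIso f.left g.left h.left)).trans (by simp)

/-- The domain 2-functor from the lax slice. -/
def dom [Strict E] (M : E) : StrictPseudofunctor (LaxSlice M) E :=
  StrictPseudofunctor.mk''
    { obj := fun X => X.left
      map := fun f => f.left
      map₂ := fun η => η.left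
      map_id := fun _ => rfl
      map_comp := fun _ _ => rfl }

end LaxSlice
end LaxSlice

section Grothendieck

variable {A : Type u₁} [Bicategory.{w₁, v₁} A]

/-- The objects of the Grothendieck construction of `W : Aᵒᵖ ⥤ CAT`: pairs `(A, X)`
with `X` an object of `W(A)`. -/
structure Groth (W : StrictPseudofunctor Aᵒᵖ Cat.{v₂, u₂}) where
  base : A
  fiber : W.obj (op base)

namespace Groth

variable {W : StrictPseudofunctor Aᵒᵖ Cat.{v₂, u₂}}

/-- A 1-cell `(A, X) ⟶ (B, X')`: a pair of `f : A ⟶ B` and `α : X ⟶ W(f)(X')`. -/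
structure Hom (x y : Groth W) where
  base : x.base ⟶ y.base
  fiber : x.fiber ⟶ (W.map base.op).toFunctor.obj y.fiber

instance : Quiver (Groth W) where
  Hom := Hom

/-- A 2-cell `(f, α) ⟶ (g, β) : (A, X) ⟶ (B, X')`: a 2-cell `δ : f ⟶ g` of `A` such that
`α` followed by `W(δ)` at `X'` is `β`. -/
structure Hom₂ {x y : Groth W} (f g : x ⟶ y) where
  base : f.base ⟶ g.base
  w : f.fiber ≫ (W.map₂ (op2 base)).toNatTrans.app y.fiber = g.fiber

instance : CategoryStruct (Groth W) where
  id x := ⟨𝟙 x.base, (W.mapId (op x.base)).inv.toNatTrans.app x.fiber⟩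
  comp {_ _ z} f g := ⟨f.base ≫ g.base, f.fiber ≫ (W.map f.base.op).toFunctor.map g.fiber ≫
    (W.mapComp g.base.op f.base.op).inv.toNatTrans.app z.fiber⟩

instance homCategory (x y : Groth W) : Category (x ⟶ y) where
  Hom := Hom₂
  id f := ⟨𝟙 f.base, by simp⟩
  comp {f g h} η θ := ⟨η.base ≫ θ.base, by
    rw [op2_comp, W.map₂_comp, Cat.Hom₂.comp_app, ← Category.assoc, η.w, θ.w]⟩
  id_comp η := by cases η; congr 1; exact Category.id_comp _
  comp_id η := by cases η; congr 1; exact Category.comp_id _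
  assoc η θ κ := by congr 1; exact Category.assoc _ _ _

@[simp] lemma id_base (x : Groth W) : Hom.base (𝟙 x) = 𝟙 x.base := rfl
@[simp] lemma id_fiber (x : Groth W) :
    Hom.fiber (𝟙 x) = (W.mapId (op x.base)).inv.toNatTrans.app x.fiber := rfl
@[simp] lemma comp_base {x y z : Groth W} (f : x ⟶ y) (g : y ⟶ z) :
    Hom.base (f ≫ g) = f.base ≫ g.base := rfl
@[simp] lemma comp_fiber {x y z : Groth W} (f : x ⟶ y) (g : y ⟶ z) :
    Hom.fiber (f ≫ g) = f.fiber ≫ (W.map f.base.op).toFunctor.map g.fiber ≫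
    (W.mapComp g.base.op f.base.op).inv.toNatTrans.app z.fiber := rfl
@[simp] lemma id₂_base {x y : Groth W} (f : x ⟶ y) : Hom₂.base (𝟙 f) = 𝟙 f.base := rfl
@[simp] lemma comp₂_base {x y : Groth W} {f g h : x ⟶ y} (η : f ⟶ g) (θ : g ⟶ h) :
    Hom₂.base (η ≫ θ) = η.base ≫ θ.base := rfl

@[ext]
lemma hom₂_ext {x y : Groth W} {f g : x ⟶ y} {η θ : f ⟶ g} (h : η.base = θ.base) : η = θ := by
  obtain ⟨_, _⟩ := η
  obtain ⟨_, _⟩ := θ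
  congr 1

/-- Build an invertible 2-cell of the Grothendieck construction from one in the base. -/
@[simps]
def isoMk {x y : Groth W} {f g : x ⟶ y} (e : f.base ≅ g.base)
    (w : f.fiber ≫ (W.map₂ (op2 e.hom)).toNatTrans.app y.fiber = g.fiber) : f ≅ g where
  hom := ⟨e.hom, w⟩
  inv := ⟨e.inv, by
    rw [← w, Category.assoc, ← Cat.Hom₂.comp_app, ← W.map₂_comp, ← op2_comp]; simp⟩
  hom_inv_id := by ext; simp
  inv_hom_id := by ext; simp

lemma whiskerLeft_w {x y z : Groth W} (f : x ⟶ y) {g h : y ⟶ z} (η : g ⟶ h) :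
    (f ≫ g).fiber ≫ (W.map₂ (op2 (f.base ◁ η.base))).toNatTrans.app z.fiber = (f ≫ h).fiber := by
  rw [comp_fiber, comp_fiber, op2_whiskerLeft, W.map₂_whisker_right, ← η.w]
  simp

lemma whiskerRight_w {x y z : Groth W} {f g : x ⟶ y} (η : f ⟶ g) (h : y ⟶ z) :
    (f ≫ h).fiber ≫ (W.map₂ (op2 (η.base ▷ h.base))).toNatTrans.app z.fiber = (g ≫ h).fiber := by
  rw [comp_fiber, comp_fiber, op2_whiskerRight, W.map₂_whisker_left, ← η.w]
  simp

lemma associator_w {x y z t : Groth W} (f : x ⟶ y) (g : y ⟶ z) (h : z ⟶ t) :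
    ((f ≫ g) ≫ h).fiber ≫
      (W.map₂ (op2 (α_ f.base g.base h.base).hom)).toNatTrans.app t.fiber =
        (f ≫ g ≫ h).fiber := by
  have e : op2 (α_ f.base g.base h.base).hom = (α_ h.base.op g.base.op f.base.op).inv := rfl
  have n := (W.mapComp g.base.op f.base.op).inv.toNatTrans.naturality h.fiber
  have m := congrArg (fun k => k.toNatTrans.app t.fiber)
    (W.mapComp_assoc_left_inv h.base.op g.base.op f.base.op)
  rw [e]
  simp at n m ⊢
  rw [← reassoc_of% n, m]

lemma leftUnitor_w {x y : Groth W} (f : x ⟶ y) :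
    (𝟙 x ≫ f).fiber ≫ (W.map₂ (op2 (λ_ f.base).hom)).toNatTrans.app y.fiber = f.fiber := by
  have e : op2 (λ_ f.base).hom = (ρ_ f.base.op).hom := rfl
  have n := (W.mapId (op x.base)).inv.toNatTrans.naturality f.fiber
  rw [e, W.map₂_right_unitor]
  simp at n ⊢

lemma rightUnitor_w {x y : Groth W} (f : x ⟶ y) :
    (f ≫ 𝟙 y).fiber ≫ (W.map₂ (op2 (ρ_ f.base).hom)).toNatTrans.app y.fiber = f.fiber := by
  have e : op2 (ρ_ f.base).hom = (λ_ f.base.op).hom := rfl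
  rw [e, W.map₂_left_unitor]
  simp [← Functor.map_comp]

instance bicategory : Bicategory (Groth W) where
  homCategory := homCategory
  whiskerLeft f _ _ η := ⟨f.base ◁ η.base, whiskerLeft_w f η⟩
  whiskerRight η h := ⟨η.base ▷ h.base, whiskerRight_w η h⟩
  associator f g h := isoMk (α_ f.base g.base h.base) (associator_w f g h)
  leftUnitor f := isoMk (λ_ f.base) (leftUnitor_w f)
  rightUnitor f := isoMk (ρ_ f.base) (rightUnitor_w f)
  whisker_exchange η θ := by ext; exact whisker_exchange _ _

@[simp] lemma whiskerLeft_base {x y z : Groth W} (f : x ⟶ y) {g h : y ⟶ z} (η : g ⟶ h) :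
    Hom₂.base (f ◁ η) = f.base ◁ η.base := rfl
@[simp] lemma whiskerRight_base {x y z : Groth W} {f g : x ⟶ y} (η : f ⟶ g) (h : y ⟶ z) :
    Hom₂.base (η ▷ h) = η.base ▷ h.base := rfl

lemma hom_eq {x y : Groth W} {f g : x ⟶ y} (η : f ⟶ g) (h : f.base = g.base)
    (hη : η.base = eqToHom h) : f = g := by
  obtain ⟨f, α⟩ := f
  obtain ⟨g, β⟩ := g
  obtain ⟨η, w⟩ := η
  dsimp at h hη w
  subst h hη
  simp at w
  rw [w]

@[simp] lemma eqToHom_base {x y : Groth W} {f g : x ⟶ y} (h : f = g) :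
    Hom₂.base (eqToHom h) = eqToHom (congrArg Hom.base h) := by
  subst h; rfl

instance strict [Strict A] : Strict (Groth W) where
  id_comp f := hom_eq (λ_ f).hom (Strict.id_comp _)
    (congrArg Iso.hom (Strict.leftUnitor_eqToIso f.base))
  comp_id f := hom_eq (ρ_ f).hom (Strict.comp_id _)
    (congrArg Iso.hom (Strict.rightUnitor_eqToIso f.base))
  assoc f g h := hom_eq (α_ f g h).hom (Strict.assoc _ _ _)
    (congrArg Iso.hom (Strict.associator_eqToIso f.base g.base h.base))
  leftUnitor_eqToIso f := by
    ext
    exact (congrArg Iso.hom (Strict.leftUnitor_eqToIso f.base)).trans (by simp)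
  rightUnitor_eqToIso f := by
    ext
    exact (congrArg Iso.hom (Strict.rightUnitor_eqToIso f.base)).trans (by simp)
  associator_eqToIso f g h := by
    ext
    exact (congrArg Iso.hom (Strict.associator_eqToIso f.base g.base h.base)).trans (by simp)

/-- The projection 2-functor from the Grothendieck construction. -/
def proj [Strict A] (W : StrictPseudofunctor Aᵒᵖ Cat.{v₂, u₂}) : StrictPseudofunctor (Groth W) A :=
  StrictPseudofunctor.mk''
    { obj := fun x => x.base
      map := fun f => f.base
      map₂ := fun η => η.base
      map_id := fun _ => rfl
      map_comp := fun _ _ => rfl }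

/-- The 1-cell `(f, id) : (A, W(f)(X)) ⟶ (B, X)`. -/
def cart {a b : A} (f : a ⟶ b) (X : W.obj (op b)) :
    (⟨a, (W.map f.op).toFunctor.obj X⟩ : Groth W) ⟶ ⟨b, X⟩ :=
  ⟨f, 𝟙 _⟩

end Groth
end Grothendieck

section Strict

variable {B : Type u} [Bicategory.{w, v} B] {C : Type u₁} [Bicategory.{w₁, v₁} C]

lemma map₂_whiskerLeft_eq (F : StrictPseudofunctor B C) {a b c : B} (f : a ⟶ b) {g h : b ⟶ c}
    (η : g ⟶ h) : F.map₂ (f ◁ η) = eqToHom (F.map_comp f g) ≫ F.map f ◁ F.map₂ η ≫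
      eqToHom (F.map_comp f h).symm := by
  rw [F.map₂_whisker_left, F.mapComp_eq_eqToIso, F.mapComp_eq_eqToIso]; rfl

lemma map₂_whiskerRight_eq (F : StrictPseudofunctor B C) {a b c : B} {f g : a ⟶ b} (η : f ⟶ g)
    (h : b ⟶ c) : F.map₂ (η ▷ h) = eqToHom (F.map_comp f h) ≫ F.map₂ η ▷ F.map h ≫
      eqToHom (F.map_comp g h).symm := by
  rw [F.map₂_whisker_right, F.mapComp_eq_eqToIso, F.mapComp_eq_eqToIso]; rfl

end Strict

section Cocones

variable {E : Type u} [Bicategory.{w, v} E]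
variable {A : Type u₁} [Bicategory.{w₁, v₁} A] {W : StrictPseudofunctor Aᵒᵖ Cat.{v₂, u₂}}

/-- An oplax normal 2-cocone for `D : Groth W ⥤ E` on `C`, that is, an oplax natural
transformation from the constant presheaf at the terminal category to `E(D(-), C)` whose structure
2-cells on the morphisms `(f, id)` are identities. -/
@[ext]
structure OplaxNormalCocone (D : StrictPseudofunctor (Groth W) E) (C : E) where
  app (x : Groth W) : D.obj x ⟶ C
  nat {x y : Groth W} (f : x ⟶ y) : app x ⟶ D.map f ≫ app y
  nat_id (x : Groth W) : nat (𝟙 x) = (λ_ (app x)).inv ≫ (D.mapId x).inv ▷ app x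
  nat_comp {x y z : Groth W} (f : x ⟶ y) (g : y ⟶ z) :
    nat (f ≫ g) = nat f ≫ D.map f ◁ nat g ≫ (α_ (D.map f) (D.map g) (app z)).inv ≫
      (D.mapComp f g).inv ▷ app z
  nat_map₂ {x y : Groth W} {f g : x ⟶ y} (δ : f ⟶ g) : nat f ≫ D.map₂ δ ▷ app y = nat g
  normal {a b : A} (f : a ⟶ b) (X : W.obj (op b)) :
    ∃ h : app _ = D.map (Groth.cart f X) ≫ app ⟨b, X⟩, nat (Groth.cart f X) = eqToHom h

namespace OplaxNormalCocone

variable {D : StrictPseudofunctor (Groth W) E} {C : E}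

/-- Modifications between oplax normal 2-cocones. -/
@[ext]
structure Hom (θ σ : OplaxNormalCocone D C) where
  app (x : Groth W) : θ.app x ⟶ σ.app x
  naturality {x y : Groth W} (f : x ⟶ y) :
    θ.nat f ≫ D.map f ◁ app y = app x ≫ σ.nat f

/-- Oplax normal 2-cocones for `D` on `C` and modifications form a category. -/
instance category : Category (OplaxNormalCocone D C) where
  Hom := Hom
  id θ := ⟨fun x => 𝟙 _, fun f => by simp⟩
  comp m n := ⟨fun x => m.app x ≫ n.app x, fun f => by
    rw [whiskerLeft_comp, reassoc_of% m.naturality f, n.naturality f, Category.assoc]⟩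
  id_comp m := Hom.ext (funext fun _ => Category.id_comp _)
  comp_id m := Hom.ext (funext fun _ => Category.comp_id _)
  assoc m n k := Hom.ext (funext fun _ => Category.assoc _ _ _)

@[simp] lemma id_app (θ : OplaxNormalCocone D C) (x : Groth W) : Hom.app (𝟙 θ) x = 𝟙 _ := rfl
@[simp] lemma comp_app {θ σ τ : OplaxNormalCocone D C} (m : θ ⟶ σ) (n : σ ⟶ τ) (x : Groth W) :
    Hom.app (m ≫ n) x = m.app x ≫ n.app x := rfl

@[ext]
lemma hom_ext {θ σ : OplaxNormalCocone D C} {m n : θ ⟶ σ} (h : ∀ x, m.app x = n.app x) : m = n :=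
  Hom.ext (funext h)

/-- Postcomposition of an oplax normal 2-cocone on `C` with a 1-cell out of `C`. -/
@[simps]
def postcompObj [Strict E] (θ : OplaxNormalCocone D C) {U : E} (h : C ⟶ U) :
    OplaxNormalCocone D U where
  app x := θ.app x ≫ h
  nat {x y} f := θ.nat f ▷ h ≫ (α_ (D.map f) (θ.app y) h).hom
  nat_id x := by simp [θ.nat_id]
  nat_comp f g := by simp [θ.nat_comp]
  nat_map₂ {x y f g} δ := by
    rw [← θ.nat_map₂ δ]; simp
  normal {a b} f X := by
    obtain ⟨e, he⟩ := θ.normal f X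
    refine ⟨(congrArg (· ≫ h) e).trans (Strict.assoc _ _ _), ?_⟩
    rw [he, eqToHom_whiskerRight, Strict.associator_eqToIso]
    simp

/-- The functor `E(C, U) ⥤ OplaxNormalCocone D U` given by postcomposition of `θ`. -/
@[simps]
def postcomp [Strict E] (θ : OplaxNormalCocone D C) (U : E) :
    (C ⟶ U) ⥤ OplaxNormalCocone D U where
  obj h := θ.postcompObj h
  map {h k} η :=
    { app := fun x => θ.app x ◁ η
      naturality := fun {x y} f => by
        change (θ.nat f ▷ h ≫ (α_ (D.map f) (θ.app y) h).hom) ≫ D.map f ◁ θ.app y ◁ η =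
          θ.app x ◁ η ≫ θ.nat f ▷ k ≫ (α_ (D.map f) (θ.app y) k).hom
        rw [Category.assoc, ← associator_naturality_right, whisker_exchange_assoc] }
  map_id h := hom_ext fun x => whiskerLeft_id (θ.app x) h
  map_comp η κ := hom_ext fun x => whiskerLeft_comp (θ.app x) η κ

/-- `θ` exhibits `C` as the oplax normal conical 2-colimit of `D`: for every `U`, postcomposition
with `θ` is an isomorphism of categories from `E(C, U)` to the category of oplax normal 2-cocones
on `U`. -/
def IsUniversal [Strict E] (θ : OplaxNormalCocone D C) : Prop :=
  ∀ U : E, (θ.postcomp U).IsIso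

/-- The image of an oplax normal 2-cocone under a 2-functor `p`. -/
@[simps]
def mapCocone {S : Type u₃} [Bicategory.{w₃, v₃} S] {H : StrictPseudofunctor (Groth W) S} {s : S}
    (ζ : OplaxNormalCocone H s) (p : StrictPseudofunctor S E) :
    OplaxNormalCocone (H.comp p) (p.obj s) where
  app x := p.map (ζ.app x)
  nat {x y} f := p.map₂ (ζ.nat f) ≫ (p.mapComp (H.map f) (ζ.app y)).hom
  nat_id x := by
    change p.map₂ (ζ.nat (𝟙 x)) ≫ (p.mapComp (H.map (𝟙 x)) (ζ.app x)).hom =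
      (λ_ (p.map (ζ.app x))).inv ≫
        ((p.mapId (H.obj x)).inv ≫ p.map₂ (H.mapId x).inv) ▷ p.map (ζ.app x)
    rw [ζ.nat_id]
    simp [Pseudofunctor.whiskerRight_mapId_inv]
  nat_comp {x y z} f g := by
    change p.map₂ (ζ.nat (f ≫ g)) ≫ (p.mapComp (H.map (f ≫ g)) (ζ.app z)).hom =
      (p.map₂ (ζ.nat f) ≫ (p.mapComp (H.map f) (ζ.app y)).hom) ≫
        p.map (H.map f) ◁ (p.map₂ (ζ.nat g) ≫ (p.mapComp (H.map g) (ζ.app z)).hom) ≫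
          (α_ (p.map (H.map f)) (p.map (H.map g)) (p.map (ζ.app z))).inv ≫
            ((p.mapComp (H.map f) (H.map g)).inv ≫
              p.map₂ (H.mapComp f g).inv) ▷ p.map (ζ.app z)
    have key : (p.mapComp (H.map f) (H.map g ≫ ζ.app z)).inv ≫
        p.map₂ (α_ (H.map f) (H.map g) (ζ.app z)).inv ≫
          (p.mapComp (H.map f ≫ H.map g) (ζ.app z)).hom =
        p.map (H.map f) ◁ (p.mapComp (H.map g) (ζ.app z)).hom ≫
          (α_ (p.map (H.map f)) (p.map (H.map g)) (p.map (ζ.app z))).inv ≫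
            (p.mapComp (H.map f) (H.map g)).inv ▷ p.map (ζ.app z) := by
      rw [Iso.inv_comp_eq, p.mapComp_assoc_right_hom_assoc]
      simp
    rw [ζ.nat_comp]
    simp [reassoc_of% key]
  nat_map₂ {x y f g} δ := by
    change (p.map₂ (ζ.nat f) ≫ (p.mapComp (H.map f) (ζ.app y)).hom) ≫
      p.map₂ (H.map₂ δ) ▷ p.map (ζ.app y) =
        p.map₂ (ζ.nat g) ≫ (p.mapComp (H.map g) (ζ.app y)).hom
    rw [← ζ.nat_map₂ δ]
    simp
  normal {a b} f X := by
    obtain ⟨e, he⟩ := ζ.normal f X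
    refine ⟨(congrArg p.map e).trans (p.map_comp _ _), ?_⟩
    rw [he, p.mapComp_eq_eqToIso, PrelaxFunctor.map₂_eqToHom]
    rw [eqToIso.hom]
    exact eqToHom_trans _ _

/-- An oplax normal 2-cocone on `M` reorganized as a 2-diagram in the lax slice over `M`. -/
def toLaxSlice [Strict A] [Strict E] {M : E} (θ : OplaxNormalCocone D M) :
    StrictPseudofunctor (Groth W) (LaxSlice M) :=
  StrictPseudofunctor.mk''
    { obj := fun x => ⟨D.obj x, θ.app x⟩
      map := fun f => ⟨D.map f, θ.nat f⟩
      map₂ := fun δ => ⟨D.map₂ δ, θ.nat_map₂ δ⟩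
      map₂_id := fun f => LaxSlice.hom₂_ext (D.map₂_id f)
      map₂_comp := fun η κ => LaxSlice.hom₂_ext (D.map₂_comp η κ)
      map_id := fun x => (LaxSlice.hom_eq
        (f := 𝟙 (⟨D.obj x, θ.app x⟩ : LaxSlice M)) (g := ⟨D.map (𝟙 x), θ.nat (𝟙 x)⟩)
        ⟨(D.mapId x).inv, (θ.nat_id x).symm⟩ (D.map_id x).symm
        (congrArg Iso.inv (D.mapId_eq_eqToIso x))).symm
      map_comp := fun {x y z} f g => (LaxSlice.hom_eq
        (X := ⟨D.obj x, θ.app x⟩) (Y := ⟨D.obj z, θ.app z⟩)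
        (f := LaxSlice.Hom.mk (Y := ⟨D.obj y, θ.app y⟩) (D.map f) (θ.nat f) ≫
          LaxSlice.Hom.mk (D.map g) (θ.nat g))
        (g := ⟨D.map (f ≫ g), θ.nat (f ≫ g)⟩)
        ⟨(D.mapComp f g).inv, by simp [θ.nat_comp]⟩
        (D.map_comp f g).symm
        (congrArg Iso.inv (D.mapComp_eq_eqToIso f g))).symm
      map₂_whisker_left := fun f _ _ η => LaxSlice.hom₂_ext (by
        rw [LaxSlice.comp₂_left, LaxSlice.comp₂_left, LaxSlice.eqToHom_left,
          LaxSlice.eqToHom_left]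
        exact map₂_whiskerLeft_eq D f η)
      map₂_whisker_right := fun η h => LaxSlice.hom₂_ext (by
        rw [LaxSlice.comp₂_left, LaxSlice.comp₂_left, LaxSlice.eqToHom_left,
          LaxSlice.eqToHom_left]
        exact map₂_whiskerRight_eq D η h) }

end OplaxNormalCocone
end Cocones

section Weighted

variable {E : Type u} [Bicategory.{w, v} E]
variable {A : Type u₁} [Bicategory.{w₁, v₁} A]

/-- A weighted 2-cocylinder: a (strict) 2-natural transformation `W ⟶ E(F(-), C)`. Naturality in
1-cells is the equality of the functors `W(f)` followed by `app a` and `app b` followed by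
precomposition with `F(f)`, on objects and on morphisms. -/
@[ext]
structure Cocylinder (W : StrictPseudofunctor Aᵒᵖ Cat.{v₂, u₂}) (F : StrictPseudofunctor A E)
    (C : E) where
  app (a : A) : W.obj (op a) ⥤ (F.obj a ⟶ C)
  naturality_obj {a b : A} (f : a ⟶ b) (X : W.obj (op b)) :
    (app a).obj ((W.map f.op).toFunctor.obj X) = F.map f ≫ (app b).obj X
  naturality_map {a b : A} (f : a ⟶ b) {X Y : W.obj (op b)} (α : X ⟶ Y) :
    (app a).map ((W.map f.op).toFunctor.map α) ≫ eqToHom (naturality_obj f Y) =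
      eqToHom (naturality_obj f X) ≫ F.map f ◁ (app b).map α
  naturality₂ {a b : A} {f g : a ⟶ b} (δ : f ⟶ g) (X : W.obj (op b)) :
    (app a).map ((W.map₂ (op2 δ)).toNatTrans.app X) ≫ eqToHom (naturality_obj g X) =
      eqToHom (naturality_obj f X) ≫ F.map₂ δ ▷ (app b).obj X

namespace Cocylinder

variable {W : StrictPseudofunctor Aᵒᵖ Cat.{v₂, u₂}} {F : StrictPseudofunctor A E} {C : E}

/-- Modifications between weighted 2-cocylinders. -/
@[ext]
structure Hom (μ ν : Cocylinder W F C) where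
  app (a : A) : μ.app a ⟶ ν.app a
  naturality {a b : A} (f : a ⟶ b) (X : W.obj (op b)) :
    (app a).app ((W.map f.op).toFunctor.obj X) ≫ eqToHom (ν.naturality_obj f X) =
      eqToHom (μ.naturality_obj f X) ≫ F.map f ◁ (app b).app X

/-- Weighted 2-cocylinders and modifications form a category. -/
instance category : Category (Cocylinder W F C) where
  Hom := Hom
  id μ := ⟨fun a => 𝟙 _, fun f X => by simp⟩
  comp {μ ν κ} m n := ⟨fun a => m.app a ≫ n.app a, fun f X => by
    rw [NatTrans.comp_app, NatTrans.comp_app, Category.assoc, n.naturality f,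
      reassoc_of% m.naturality f, whiskerLeft_comp]⟩
  id_comp m := Hom.ext (funext fun _ => Category.id_comp _)
  comp_id m := Hom.ext (funext fun _ => Category.comp_id _)
  assoc m n k := Hom.ext (funext fun _ => Category.assoc _ _ _)

@[simp] lemma id_app (μ : Cocylinder W F C) (a : A) : Hom.app (𝟙 μ) a = 𝟙 _ := rfl
@[simp] lemma comp_app {μ ν κ : Cocylinder W F C} (m : μ ⟶ ν) (n : ν ⟶ κ) (a : A) :
    Hom.app (m ≫ n) a = m.app a ≫ n.app a := rfl

@[ext]
lemma hom_ext {μ ν : Cocylinder W F C} {m n : μ ⟶ ν} (h : ∀ a, m.app a = n.app a) : m = n :=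
  Hom.ext (funext h)

/-- Postcomposition of a weighted 2-cocylinder on `C` with a 1-cell out of `C`. -/
@[simps]
def postcompObj [Strict E] (μ : Cocylinder W F C) {U : E} (h : C ⟶ U) : Cocylinder W F U where
  app a := μ.app a ⋙ Bicategory.postcomp (F.obj a) h
  naturality_obj {a b} f X :=
    (congrArg (· ≫ h) (μ.naturality_obj f X)).trans (Strict.assoc _ _ _)
  naturality_map {a b} f X Y α := by
    have := congrArg (fun t => t ▷ h ≫ (α_ _ _ _).hom) (μ.naturality_map f α)
    simp [Strict.associator_eqToIso] at this
    exact this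
  naturality₂ {a b f g} δ X := by
    have := congrArg (fun t => t ▷ h ≫ (α_ _ _ _).hom) (μ.naturality₂ δ X)
    have key : F.map₂ δ ▷ ((μ.app b).obj X ≫ h) = eqToHom (Strict.assoc _ _ _).symm ≫
        F.map₂ δ ▷ (μ.app b).obj X ▷ h ≫ eqToHom (Strict.assoc _ _ _) := by
      simp [Strict.associator_eqToIso]
    refine Eq.trans ?_ (congrArg (eqToHom _ ≫ ·) key.symm)
    simp [Strict.associator_eqToIso] at this
    exact this.trans (eqToHom_trans_assoc _ _ _).symm

/-- The functor `E(C, U) ⥤ Cocylinder W F U` given by postcomposition of `μ`. -/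
@[simps]
def postcomp [Strict E] (μ : Cocylinder W F C) (U : E) : (C ⟶ U) ⥤ Cocylinder W F U where
  obj h := μ.postcompObj h
  map {h k} η :=
    { app := fun a => Functor.whiskerLeft (μ.app a) ((postcomposing (F.obj a) C U).map η)
      naturality := fun {a b} f X => by
        change ((μ.app a).obj ((W.map f.op).toFunctor.obj X)) ◁ η ≫ eqToHom _ =
          eqToHom _ ≫ F.map f ◁ ((μ.app b).obj X ◁ η)
        rw [congr_whiskerLeft (μ.naturality_obj f X) η, comp_whiskerLeft,
          Strict.associator_eqToIso, Strict.associator_eqToIso]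
        simp only [eqToIso.hom, eqToIso.inv, Category.assoc, eqToHom_trans_assoc]
        refine congrArg (eqToHom _ ≫ ·) ?_
        refine (congrArg (F.map f ◁ (μ.app b).obj X ◁ η ≫ ·)
          (eqToHom_trans _ _)).trans ?_
        exact Category.comp_id _ }
  map_id h := hom_ext fun a => by ext X; exact whiskerLeft_id _ _
  map_comp η κ := hom_ext fun a => by ext X; exact whiskerLeft_comp _ _ _

/-- `μ` exhibits `C` as the 2-colimit of `F` weighted by `W`: for every `U`, postcomposition
with `μ` is an isomorphism of categories from `E(C, U)` to the category of weighted 2-cocylinders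
on `U`. -/
def IsUniversal [Strict E] (μ : Cocylinder W F C) : Prop :=
  ∀ U : E, (μ.postcomp U).IsIso

lemma app_map_mapId_inv (μ : Cocylinder W F C) {a : A} (X : W.obj (op a)) :
    (μ.app a).map ((W.mapId (op a)).inv.toNatTrans.app X) =
      eqToHom (congrArg (fun t => (μ.app a).obj (t.toFunctor.obj X)) (W.map_id (op a)).symm) := by
  rw [W.mapId_eq_eqToIso]
  simp [eqToHom_map]

lemma app_map_mapComp_inv (μ : Cocylinder W F C) {a b c : A} (f : a ⟶ b) (g : b ⟶ c)
    (X : W.obj (op c)) :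
    (μ.app a).map ((W.mapComp g.op f.op).inv.toNatTrans.app X) =
      eqToHom (congrArg (fun t => (μ.app a).obj (t.toFunctor.obj X))
        (W.map_comp g.op f.op).symm) := by
  rw [W.mapComp_eq_eqToIso]
  simp [eqToHom_map]

lemma toCocone_nat_id [Strict E] (μ : Cocylinder W F C) {a : A} (X : W.obj (op a)) :
    (μ.app a).map ((W.mapId (op a)).inv.toNatTrans.app X) ≫ eqToHom (μ.naturality_obj (𝟙 a) X) =
      (λ_ ((μ.app a).obj X)).inv ≫ eqToHom (F.map_id a).symm ▷ (μ.app a).obj X := by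
  rw [app_map_mapId_inv, Strict.leftUnitor_eqToIso, eqToHom_whiskerRight, eqToIso.inv]
  exact (eqToHom_trans _ _).trans (eqToHom_trans _ _).symm

lemma toCocone_nat_comp [Strict E] (μ : Cocylinder W F C) {a b c : A} (f : a ⟶ b) (g : b ⟶ c)
    {X : W.obj (op a)} {Y : W.obj (op b)} {Z : W.obj (op c)}
    (α : X ⟶ (W.map f.op).toFunctor.obj Y) (β : Y ⟶ (W.map g.op).toFunctor.obj Z) :
    (μ.app a).map (α ≫ (W.map f.op).toFunctor.map β ≫
        (W.mapComp g.op f.op).inv.toNatTrans.app Z) ≫ eqToHom (μ.naturality_obj (f ≫ g) Z) =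
      ((μ.app a).map α ≫ eqToHom (μ.naturality_obj f Y)) ≫
        F.map f ◁ ((μ.app b).map β ≫ eqToHom (μ.naturality_obj g Z)) ≫
          (α_ (F.map f) (F.map g) ((μ.app c).obj Z)).inv ≫
            eqToHom (F.map_comp f g).symm ▷ (μ.app c).obj Z := by
  have n := (μ.naturality_map f β)
  rw [Functor.map_comp, Functor.map_comp, app_map_mapComp_inv, eqToHom_whiskerRight,
    Strict.associator_eqToIso, whiskerLeft_comp, whiskerLeft_eqToHom, eqToIso.inv]
  simp only [Category.assoc]
  rw [← reassoc_of% n]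
  refine congrArg (_ ≫ ·) (congrArg (_ ≫ ·) ?_)
  refine (eqToHom_trans _ _).trans ?_
  simp

/-- The oplax normal 2-cocone for the composite of the projection of the Grothendieck construction
with `F` that corresponds to a weighted 2-cocylinder. -/
def toCocone [Strict A] [Strict E] (μ : Cocylinder W F C) :
    OplaxNormalCocone ((Groth.proj W).comp F) C where
  app x := (μ.app x.base).obj x.fiber
  nat {x y} f := (μ.app x.base).map f.fiber ≫ eqToHom (μ.naturality_obj f.base y.fiber)
  nat_id x := by
    have h : (((Groth.proj W).comp F).mapId x).inv = eqToHom (F.map_id x.base).symm := by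
      rw [StrictlyUnitaryPseudofunctor.mapId_eq_eqToIso]; rfl
    rw [h]
    exact μ.toCocone_nat_id x.fiber
  nat_comp {x y z} f g := by
    have h : (((Groth.proj W).comp F).mapComp f g).inv =
        eqToHom (F.map_comp f.base g.base).symm := by
      rw [StrictPseudofunctor.mapComp_eq_eqToIso]; rfl
    rw [h]
    exact μ.toCocone_nat_comp f.base g.base f.fiber g.fiber
  nat_map₂ {x y f g} δ := by
    change ((μ.app x.base).map f.fiber ≫ eqToHom (μ.naturality_obj f.base y.fiber)) ≫
      F.map₂ δ.base ▷ (μ.app y.base).obj y.fiber = _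
    rw [Category.assoc, ← μ.naturality₂, ← δ.w, ← Functor.map_comp_assoc]
    rfl
  normal {a b} f X := ⟨μ.naturality_obj f X, by
    refine Eq.trans (congrArg (· ≫ eqToHom (μ.naturality_obj f X)) ((μ.app a).map_id _)) ?_
    exact Category.id_comp _⟩

end Cocylinder
end Weighted

section Fibrations

variable {S : Type u₃} [Bicategory.{w₃, v₃} S] [Strict S] {E : Type u} [Bicategory.{w, v} E]
  [Strict E]

/-- A cleavage for a 2-functor `p`: for every `s` in `S` and every 1-cell `f` into `p(s)`, a
chosen 1-cell into `s` over `f` that is cartesian for the functor underlying `p`. -/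
structure Cleavage (p : StrictPseudofunctor S E) where
  lift {s : S} {e : E} (f : e ⟶ p.obj s) : Σ s' : S, s' ⟶ s
  cartesian {s : S} {e : E} (f : e ⟶ p.obj s) :
    p.toFunctor.IsStronglyCartesian (S := p.obj s) f (lift f).2

/-- `p` is locally a discrete opfibration: every 2-cell out of `p(h)` has a unique lift to a
2-cell out of `h`. -/
def LocallyDiscreteOpfibration (p : StrictPseudofunctor S E) : Prop :=
  ∀ {x y : S} (h : x ⟶ y) {k : p.obj x ⟶ p.obj y} (δ : p.map h ⟶ k),
    ∃! l : Σ k' : x ⟶ y, h ⟶ k',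
      (⟨p.map l.1, p.map₂ l.2⟩ : Σ k : p.obj x ⟶ p.obj y, p.map h ⟶ k) = ⟨k, δ⟩

variable {A : Type u₁} [Bicategory.{w₁, v₁} A] {W : StrictPseudofunctor Aᵒᵖ Cat.{v₂, u₂}}

/-- `(H, ζ)` is the lifting of `(D, θ)` through `p` to `s` determined by the cleavage: it lies
over `(D, θ)` and the components of `ζ` are the chosen cartesian liftings of those of `θ`. -/
structure Cleavage.IsLifting {p : StrictPseudofunctor S E} (c : Cleavage p) {s : S}
    {D : StrictPseudofunctor (Groth W) E} (θ : OplaxNormalCocone D (p.obj s))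
    (H : StrictPseudofunctor (Groth W) S) (ζ : OplaxNormalCocone H s) : Prop where
  lies_over : (⟨H.comp p, ζ.mapCocone p⟩ :
    Σ D : StrictPseudofunctor (Groth W) E, OplaxNormalCocone D (p.obj s)) = ⟨D, θ⟩
  chosen (x : Groth W) : (⟨H.obj x, ζ.app x⟩ : Σ s' : S, s' ⟶ s) = c.lift (θ.app x)

end Fibrations

/-- A 2-functor `p` equipped with a cleavage is a 2-colim-fibration if it is a 2-Set-fibration
(it has cartesian liftings of 1-cells, here given by the cleavage, and is locally a discrete
opfibration) and, for every universal oplax normal 2-cocone `θ` on `p(s)`, the lifting of `θ`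
through `p` to `s` (which exists and is unique) is universal. -/
structure IsTwoColimFibration {S : Type u₃} [Bicategory.{w₃, v₃} S] [Strict S]
    {E : Type u} [Bicategory.{w, v} E] [Strict E]
    (p : StrictPseudofunctor S E) (c : Cleavage p) : Prop where
  locallyDiscreteOpfibration : LocallyDiscreteOpfibration p
  lifting (s : S) {A : Type u₁} [Bicategory.{w₁, v₁} A] [Strict A]
    (W : StrictPseudofunctor Aᵒᵖ Cat.{v₂, u₂}) (D : StrictPseudofunctor (Groth W) E)
    (θ : OplaxNormalCocone D (p.obj s)) (hθ : θ.IsUniversal) :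
    (∃! L : Σ H : StrictPseudofunctor (Groth W) S, OplaxNormalCocone H s,
        c.IsLifting θ L.1 L.2) ∧
      ∀ (H : StrictPseudofunctor (Groth W) S) (ζ : OplaxNormalCocone H s),
        c.IsLifting θ H ζ → ζ.IsUniversal

namespace LaxSlice

variable {E : Type u} [Bicategory.{w, v} E] [Strict E] {M : E}

/-- The canonical cleavage: the chosen lifting to `g` of a 1-cell `f` is `(f, id)`. -/
def IsCanonicalCleavage (c : Cleavage (dom M)) : Prop :=
  ∀ (g : LaxSlice M) {e : E} (f : e ⟶ g.left),
    c.lift (s := g) f = ⟨⟨e, f ≫ g.hom⟩, ⟨f, 𝟙 (f ≫ g.hom)⟩⟩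

end LaxSlice
end TwoColim

open TwoColim

/-! The argument rests on one fact: the cartesian 1-cells for `dom` are those whose filling 2-cell
is invertible; only one implication is needed beyond the cartesianness of `(f, id)`. The canonical
lift `(f, id)` is cartesian. Any other cartesian lift differs from it by an isomorphism of the lax
slice, and such an isomorphism has an invertible filler (`isIso_cell_of_isIso`). So every cleavage
chooses lifts `(f, γ)` with `γ` invertible, and all cleavages can be treated at once.

Liftings exist and are unique because a structure 2-cell of a cocone in the slice must be compatible
with the fillers of its two components. When these fillers are invertible, the equation can be
solved in exactly one way for the filler of the diagram's 1-cell; the solution is `liftCell`, and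
conjugation by the `γ`s respects identities, composition and 2-cells (`eq_liftCocone`).

For universality, let `θ` be the underlying cocone, and test against `U`, a 1-cell `u` into `M`. The
universal property of `θ` is used twice. At the domain of `u` it produces the underlying 1-cell `h`
and the underlying 2-cells. At `M` it produces the filler from `q` to `h ≫ u`: the fillers of a
competing cocone, precomposed with the inverses of the `γ`s, form a modification between
postcomposites of `θ`, and this comes from a unique 2-cell (`isUniversal_of_mapCocone_dom`).

For weighted colimits, a 1-cell `(f, α)` of the Grothendieck construction is, up to a unit 2-cell, a
vertical 1-cell followed by `(f, id)`. Normality trivializes the second factor, so a normal cocone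
is the same as functors on the fibers with strict naturality, that is, a 2-natural transformation
out of `W`. The correspondence respects modifications and postcomposition and so carries
universality across (`toCocone_isUniversal`). -/

namespace TwoColim

/-! ### Equality of strict 2-functors, cocones and slice 2-cells. -/

section Extensionality

/-- Strictness makes the coherence isomorphisms `eqToIso`s, so they carry no data beyond the action
on cells. -/
lemma strictPseudofunctor_ext {B : Type u} [Bicategory.{w, v} B] {C : Type u₁}
    [Bicategory.{w₁, v₁} C] {F G : StrictPseudofunctor B C} (obj : ∀ x, F.obj x = G.obj x)
    (map : ∀ {x y : B} (f : x ⟶ y), F.map f ≍ G.map f)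
    (map₂ : ∀ {x y : B} {f g : x ⟶ y} (η : f ⟶ g), F.map₂ η ≍ G.map₂ η) : F = G := by
  rcases F with ⟨⟨⟨⟨⟨⟨Fo, Fm⟩, Fm₂⟩, _, _⟩, Fi, Fc⟩, _, Fi'⟩, _, Fc'⟩
  rcases G with ⟨⟨⟨⟨⟨⟨Go, Gm⟩, Gm₂⟩, _, _⟩, Gi, Gc⟩, _, Gi'⟩, _, Gc'⟩
  dsimp at obj map map₂ Fi' Fc' Gi' Gc'
  obtain rfl : Fo = Go := funext obj
  obtain rfl : @Fm = @Gm := by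
    funext x y f
    exact eq_of_heq (map f)
  obtain rfl : @Fm₂ = @Gm₂ := by
    funext x y f g η
    exact eq_of_heq (map₂ η)
  obtain rfl : Fi = Gi := funext fun x => (Fi' x).trans (Gi' x).symm
  obtain rfl : @Fc = @Gc := by
    funext x y z f g
    exact (Fc' f g).trans (Gc' f g).symm
  rfl

variable {E : Type u} [Bicategory.{w, v} E]
variable {A : Type u₁} [Bicategory.{w₁, v₁} A] {W : StrictPseudofunctor Aᵒᵖ Cat.{v₂, u₂}}

namespace OplaxNormalCocone

lemma eq_of_nat_heq {D : StrictPseudofunctor (Groth W) E} {C : E} {θ σ : OplaxNormalCocone D C}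
    (app : ∀ x, θ.app x = σ.app x)
    (nat : ∀ {x y : Groth W} (f : x ⟶ y), θ.nat f ≍ σ.nat f) : θ = σ := by
  cases θ with | mk a n => ?_
  cases σ with | mk b m => ?_
  dsimp at app nat
  obtain rfl : a = b := funext app
  obtain rfl : @n = @m := by
    funext x y f
    exact eq_of_heq (nat f)
  rfl

/-- A modification whose components are identities forces its source and target to agree. -/
lemma eq_of_hom {D : StrictPseudofunctor (Groth W) E} {C : E} {θ σ : OplaxNormalCocone D C}
    (m : θ ⟶ σ) (h : ∀ x, θ.app x = σ.app x) (hm : ∀ x, m.app x = eqToHom (h x)) : θ = σ := by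
  cases θ with | mk a n => ?_
  cases σ with | mk b k => ?_
  dsimp at h hm
  obtain rfl : a = b := funext h
  obtain rfl : @n = @k := by
    funext x y f
    have := m.naturality f
    simpa [hm] using this
  rfl

lemma sigma_ext {C : E} {L L' : Σ D : StrictPseudofunctor (Groth W) E, OplaxNormalCocone D C}
    (obj : ∀ x, L.1.obj x = L'.1.obj x)
    (map : ∀ {x y : Groth W} (f : x ⟶ y), L.1.map f ≍ L'.1.map f)
    (map₂ : ∀ {x y : Groth W} {f g : x ⟶ y} (η : f ⟶ g), L.1.map₂ η ≍ L'.1.map₂ η)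
    (app : ∀ x, L.2.app x ≍ L'.2.app x)
    (nat : ∀ {x y : Groth W} (f : x ⟶ y), L.2.nat f ≍ L'.2.nat f) : L = L' := by
  obtain ⟨D, θ⟩ := L
  obtain ⟨D', θ'⟩ := L'
  obtain rfl : D = D' := strictPseudofunctor_ext obj map map₂
  obtain rfl : θ = θ' := eq_of_nat_heq (fun x => eq_of_heq (app x)) nat
  rfl

lemma eqToHom_app {D : StrictPseudofunctor (Groth W) E} {C : E} {θ σ : OplaxNormalCocone D C}
    (h : θ = σ) (x : Groth W) :
    Hom.app (eqToHom h) x = eqToHom (congrArg (fun τ => τ.app x) h) := by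
  subst h; rfl

lemma eqToHom_comp_comp_eqToHom_app {D : StrictPseudofunctor (Groth W) E} {C : E}
    {θ θ' σ σ' : OplaxNormalCocone D C} (h : θ = θ') (m : θ' ⟶ σ) (k : σ = σ') (x : Groth W) :
    Hom.app (eqToHom h ≫ m ≫ eqToHom k) x =
      eqToHom (congrArg (fun τ => τ.app x) h) ≫ Hom.app m x ≫
        eqToHom (congrArg (fun τ => τ.app x) k) := by
  rw [comp_app, comp_app, eqToHom_app, eqToHom_app]

end OplaxNormalCocone

lemma LaxSlice.hom₂_heq {M : E} {X Y : LaxSlice M} {f f' g g' : X ⟶ Y} (hf : f = f')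
    (hg : g = g') {η : f ⟶ g} {η' : f' ⟶ g'} (h : η.left ≍ η'.left) : η ≍ η' := by
  subst hf hg
  exact heq_of_eq (hom₂_ext (eq_of_heq h))

end Extensionality

/-! ### Cartesian 1-cells and discrete opfibrations for `dom`. -/

namespace LaxSlice

variable {E : Type u} [Bicategory.{w, v} E] [Strict E] {M : E}

/-- The canonical lifting `(f, id)` to `g` of a 1-cell `f`. -/
def canonicalLift (g : LaxSlice M) {e : E} (f : e ⟶ g.left) :
    (⟨e, f ≫ g.hom⟩ : LaxSlice M) ⟶ g :=
  ⟨f, 𝟙 (f ≫ g.hom)⟩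

lemma dom_isHomLift_iff {X Y : LaxSlice M} (f : X.left ⟶ Y.left) (φ : X ⟶ Y) :
    (dom M).toFunctor.IsHomLift (R := X.left) (S := Y.left) f φ ↔ f = φ.left := by
  constructor
  · intro h
    exact @IsHomLift.eq_of_isHomLift _ _ _ _ (dom M).toFunctor X Y f φ h
  · rintro rfl
    exact IsHomLift.map (dom M).toFunctor φ

/-- A filler into `(k ≫ f) ≫ g.hom` is, by the associator, the same as a filler into `k ≫ (f ≫
g.hom)`; this gives the factorization and leaves no choice in it. -/
lemma canonicalLift_isStronglyCartesian (g : LaxSlice M) {e : E} (f : e ⟶ g.left) :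
    (dom M).toFunctor.IsStronglyCartesian (R := e) (S := g.left) f (canonicalLift g f) where
  toIsHomLift := (dom_isHomLift_iff _ _).2 rfl
  universal_property' := by
    intro X (k : X.left ⟶ e) φ hφ
    obtain ⟨l, c⟩ := φ
    obtain rfl : k ≫ f = l := (dom_isHomLift_iff (Y := g) _ _).1 hφ
    refine ⟨⟨k, c ≫ (α_ k f g.hom).hom⟩, ⟨(dom_isHomLift_iff _ _).2 rfl, ?_⟩, ?_⟩
    · have : (c ≫ (α_ k f g.hom).hom) ≫ k ◁ 𝟙 (f ≫ g.hom) ≫ (α_ k f g.hom).inv = c := by simp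
      exact congrArg (Hom.mk (X := X) (Y := g) (k ≫ f)) this
    · rintro ⟨k', d⟩ ⟨hk, h⟩
      obtain rfl : k = k' := (dom_isHomLift_iff (Y := ⟨e, f ≫ g.hom⟩) _ _).1 hk
      change (⟨k ≫ f, d ≫ k ◁ 𝟙 (f ≫ g.hom) ≫ (α_ k f g.hom).inv⟩ : Hom X g) = _ at h
      have h' : d ≫ k ◁ 𝟙 (f ≫ g.hom) ≫ (α_ k f g.hom).inv = c := by
        injection h
      have : d = c ≫ (α_ k f g.hom).hom := by
        rw [← h']
        change X.hom ⟶ k ≫ f ≫ g.hom at d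
        simp
      exact congrArg (Hom.mk (X := X) (Y := ⟨e, f ≫ g.hom⟩) k) this

variable (M) in
/-- The canonical cleavage of the domain 2-functor. -/
def canonicalCleavage : Cleavage (dom M) where
  lift {g _} f := ⟨_, canonicalLift g f⟩
  cartesian {g _} f := canonicalLift_isStronglyCartesian g f

/-- The filler of a composite with the inverse is an invertible unitor. Read in both orders, this
makes the whiskered filler of `e.inv` split mono (whiskering is a functor) and split epi, hence
invertible; cancelling it leaves the filler of `e.hom`. -/
lemma isIso_cell_of_isIso {X Y : LaxSlice M} (e : X ≅ Y) : IsIso e.hom.cell := by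
  have key : ∀ {X Y : LaxSlice M} (e : X ≅ Y), IsIso (e.hom.cell ≫ e.hom.left ◁ e.inv.cell) := by
    intro X Y e
    -- Stated for a variable `f`, since the type of the filler depends on the 1-cell and blocks
    -- direct rewriting.
    have h : ∀ f : X ⟶ X, f = 𝟙 X → IsIso f.cell := by
      rintro f rfl
      rw [id_cell]
      infer_instance
    have := h (e.hom ≫ e.inv) e.hom_inv_id
    rw [comp_cell, ← Category.assoc] at this
    exact IsIso.of_isIso_comp_right _ (α_ e.hom.left e.inv.left X.hom).inv
  have h₁ := key e
  have h₂ := key e.symm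
  dsimp at h₂
  have s₂ : IsSplitMono e.inv.cell :=
    ⟨⟨_, (Category.assoc _ _ _).symm.trans
      (IsIso.hom_inv_id (e.inv.cell ≫ e.inv.left ◁ e.hom.cell))⟩⟩
  have s₃ : IsSplitMono (e.hom.left ◁ e.inv.cell) :=
    inferInstanceAs (IsSplitMono ((precomp _ e.hom.left).map e.inv.cell))
  have s₄ : IsSplitEpi (e.hom.left ◁ e.inv.cell) :=
    ⟨⟨_, (Category.assoc _ _ _).trans (IsIso.inv_hom_id (e.hom.cell ≫ e.hom.left ◁ e.inv.cell))⟩⟩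
  have : IsIso (e.hom.left ◁ e.inv.cell) := isIso_of_mono_of_isSplitEpi _
  exact IsIso.of_isIso_comp_right _ (e.hom.left ◁ e.inv.cell)

/-- The filling 2-cell of a cartesian 1-cell of the lax slice is invertible. -/
lemma isIso_cell_of_isStronglyCartesian {X Y : LaxSlice M} (φ : X ⟶ Y)
    (h : (dom M).toFunctor.IsStronglyCartesian (R := X.left) (S := Y.left) φ.left φ) :
    IsIso φ.cell := by
  have h' := canonicalLift_isStronglyCartesian Y φ.left
  let e := Functor.IsCartesian.domainUniqueUpToIso (dom M).toFunctor (S := Y.left) φ.left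
    (canonicalLift Y φ.left) φ
  have he : e.hom ≫ canonicalLift Y φ.left = φ := by simp [e]
  have := isIso_cell_of_isIso e
  rw [← he, comp_cell]
  have : IsIso (e.hom.left ◁ (canonicalLift Y φ.left).cell) := by
    change IsIso (e.hom.left ◁ 𝟙 _)
    infer_instance
  infer_instance

/-- Reduces an arbitrary cleavage to a family of invertible fillers over the given 1-cells, the only
input the liftings need. -/
lemma exists_cleavage_lift_eq (c : Cleavage (dom M)) (s : LaxSlice M) {e : E}
    (f : e ⟶ s.left) :
    ∃ (g : e ⟶ M) (γ : g ≅ f ≫ s.hom), c.lift (s := s) f = ⟨⟨e, g⟩, ⟨f, γ.hom⟩⟩ := by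
  have h := c.cartesian (s := s) f
  generalize c.lift (s := s) f = L at h
  obtain ⟨X, φ⟩ := L
  obtain rfl : X.left = e :=
    @IsHomLift.domain_eq _ _ _ _ (dom M).toFunctor _ _ _ _ f φ h.toIsHomLift
  obtain rfl : f = φ.left := (dom_isHomLift_iff f φ).1 h.toIsHomLift
  have := isIso_cell_of_isStronglyCartesian φ h
  exact ⟨X.hom, asIso φ.cell, rfl⟩

/-- The compatibility equation of a slice 2-cell expresses the filler of its target through that of
its source. -/
lemma dom_locallyDiscreteOpfibration : LocallyDiscreteOpfibration (dom M) := by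
  intro X Y h k δ
  refine ⟨⟨⟨k, h.cell ≫ δ ▷ Y.hom⟩, ⟨δ, rfl⟩⟩, rfl, ?_⟩
  rintro ⟨⟨k', c⟩, ⟨η, w⟩⟩ hl
  change (⟨k', η⟩ : Σ k : X.left ⟶ Y.left, h.left ⟶ k) = ⟨k, δ⟩ at hl
  cases hl
  dsimp at w
  subst w
  rfl

end LaxSlice
end TwoColim

/-! ### Universality passes from the image in `E` to the lax slice. -/

namespace TwoColim
namespace LaxSlice

variable {E : Type u} [Bicategory.{w, v} E] [Strict E] {M : E}
variable {A : Type u₁} [Bicategory.{w₁, v₁} A] {W : StrictPseudofunctor Aᵒᵖ Cat.{v₂, u₂}}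

open OplaxNormalCocone

section Universal

variable {H : StrictPseudofunctor (Groth W) (LaxSlice M)} {s U : LaxSlice M}

lemma mapCocone_dom_nat (ζ : OplaxNormalCocone H s) {x y : Groth W} (f : x ⟶ y) :
    (ζ.mapCocone (dom M)).nat f = (ζ.nat f).left :=
  Category.comp_id (Hom₂.left (ζ.nat f))

lemma mapCocone_dom_postcompObj (ζ : OplaxNormalCocone H s) (h : s ⟶ U) :
    (ζ.postcompObj h).mapCocone (dom M) = (ζ.mapCocone (dom M)).postcompObj h.left := by
  refine eq_of_nat_heq (fun _ => rfl) fun {x y} f => heq_of_eq ?_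
  refine (mapCocone_dom_nat _ f).trans (Eq.trans ?_
    (congrArg (fun t => t ▷ h.left ≫ (α_ (H.map f).left (ζ.app y).left h.left).hom)
      (mapCocone_dom_nat ζ f).symm))
  rfl

/-- The image in `E` of a modification of cocones in the lax slice. -/
def domHom {σ τ : OplaxNormalCocone H s} (m : σ ⟶ τ) :
    σ.mapCocone (dom M) ⟶ τ.mapCocone (dom M) where
  app x := (m.app x).left
  naturality {x y} f := by
    rw [mapCocone_dom_nat, mapCocone_dom_nat]
    exact congrArg Hom₂.left (m.naturality f)

/-- The filler `c` of the diagram's 1-cell occurs in both slice conditions `hζ` and `hσ`.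
Eliminating it between them, with `γx` and `γy` inverted, leaves naturality of `m`. -/
lemma cellHom_naturality {a b s u : E} {F : a ⟶ b} {tx : a ⟶ s} {ty : b ⟶ s} {q : s ⟶ M}
    {p : u ⟶ M} {h : s ⟶ u} {Hx : a ⟶ M} {Hy : b ⟶ M} {c : Hx ⟶ F ≫ Hy} {sx : a ⟶ u}
    {sy : b ⟶ u} (γx : Hx ≅ tx ≫ q) (γy : Hy ≅ ty ≫ q) {σx : Hx ⟶ sx ≫ p} {σy : Hy ⟶ sy ≫ p}
    {mx : sx ⟶ tx ≫ h} {my : sy ⟶ ty ≫ h} {ζf : tx ⟶ F ≫ ty} {σf : sx ⟶ F ≫ sy}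
    (hm : σf ≫ F ◁ my = mx ≫ ζf ▷ h ≫ (α_ F ty h).hom)
    (hζ : γx.hom ≫ ζf ▷ q = c ≫ F ◁ γy.hom ≫ (α_ F ty q).inv)
    (hσ : σx ≫ σf ▷ p = c ≫ F ◁ σy ≫ (α_ F sy p).inv) :
    (ζf ▷ q ≫ (α_ F ty q).hom) ≫ F ◁ (γy.inv ≫ σy ≫ my ▷ p ≫ (α_ ty h p).hom) =
      (γx.inv ≫ σx ≫ mx ▷ p ≫ (α_ tx h p).hom) ≫ ζf ▷ (h ≫ p) ≫ (α_ F ty (h ≫ p)).hom := by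
  rw [← Iso.eq_inv_comp] at hζ
  have hσ' : c ≫ F ◁ σy = σx ≫ σf ▷ p ≫ (α_ F sy p).hom := by
    rw [reassoc_of% hσ]; simp
  have hm' : σf ▷ p ≫ (α_ F sy p).hom ≫ F ◁ my ▷ p =
      (mx ▷ p ≫ ζf ▷ h ▷ p ≫ (α_ F ty h).hom ▷ p) ≫ (α_ F (ty ≫ h) p).hom := by
    rw [← comp_whiskerRight, ← comp_whiskerRight, ← hm]
    simp
  rw [hζ]
  simp only [whiskerLeft_comp, Category.assoc, Iso.inv_hom_id_assoc, whiskerLeft_hom_inv_assoc]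
  rw [reassoc_of% hσ', reassoc_of% hm']
  simp

/-- A 2-cell `q ⟶ h ≫ u` extracted from a cocone on `u` over `H` and a modification from its image
in `E` to the postcomposite of the image of `ζ` with `h`. -/
def cellHom (ζ : OplaxNormalCocone H s) (γ : ∀ x, (H.obj x).hom ≅ (ζ.app x).left ≫ s.hom)
    (hγ : ∀ x, (γ x).hom = (ζ.app x).cell)
    (σ : OplaxNormalCocone H U) (h : s.left ⟶ U.left)
    (m : σ.mapCocone (dom M) ⟶ (ζ.mapCocone (dom M)).postcompObj h) :
    (ζ.mapCocone (dom M)).postcompObj s.hom ⟶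
      (ζ.mapCocone (dom M)).postcompObj (h ≫ U.hom) where
  app x := (γ x).inv ≫ (σ.app x).cell ≫
    Hom.app m x ▷ U.hom ≫ (α_ (ζ.app x).left h U.hom).hom
  naturality {x y} f := by
    have hm := m.naturality f
    change (σ.mapCocone (dom M)).nat f ≫ (H.map f).left ◁ Hom.app m y =
      Hom.app m x ≫ (ζ.mapCocone (dom M)).nat f ▷ h ≫ (α_ (H.map f).left (ζ.app y).left h).hom
      at hm
    change ((ζ.mapCocone (dom M)).nat f ▷ s.hom ≫ (α_ (H.map f).left (ζ.app y).left s.hom).hom) ≫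
        (H.map f).left ◁ ((γ y).inv ≫ (σ.app y).cell ≫
          Hom.app m y ▷ U.hom ≫ (α_ (ζ.app y).left h U.hom).hom) =
      ((γ x).inv ≫ (σ.app x).cell ≫
          Hom.app m x ▷ U.hom ≫ (α_ (ζ.app x).left h U.hom).hom) ≫
        (ζ.mapCocone (dom M)).nat f ▷ (h ≫ U.hom) ≫
          (α_ (H.map f).left (ζ.app y).left (h ≫ U.hom)).hom
    rw [mapCocone_dom_nat] at hm ⊢
    rw [mapCocone_dom_nat] at hm
    refine cellHom_naturality (γ x) (γ y) hm ?_ (σ.nat f).w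
    rw [hγ, hγ]
    exact (ζ.nat f).w

lemma cell_reassoc {a b c : E} {g : a ⟶ M} {t : a ⟶ b} {q : b ⟶ M} {u : c ⟶ M} {h : b ⟶ c}
    {l : a ⟶ c} (γ : g ≅ t ≫ q) (σ : g ⟶ l ≫ u) (m : l ⟶ t ≫ h) :
    γ.hom ≫ (γ.inv ≫ σ ≫ m ▷ u ≫ (α_ t h u).hom) ≫ (α_ t h u).inv = σ ≫ m ▷ u := by
  simp

/-- The invertible `γ` and an associator cancel from the outer sides of `w`, which lets the slice
condition on `δ` be tested on components of the cocone. -/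
lemma whiskerLeft_cell_eq {a b c : E} {g : a ⟶ M} {t : a ⟶ b} {q : b ⟶ M} {u : c ⟶ M}
    {h k : b ⟶ c} {γ : g ⟶ t ≫ q} [IsIso γ] {x : q ⟶ h ≫ u} {y : q ⟶ k ≫ u} {δ : h ⟶ k}
    (w : (γ ≫ t ◁ x ≫ (α_ t h u).inv) ≫ (t ◁ δ) ▷ u = γ ≫ t ◁ y ≫ (α_ t k u).inv) :
    t ◁ (x ≫ δ ▷ u) = t ◁ y := by
  rw [← cancel_mono (α_ t k u).inv, ← cancel_epi γ, ← w]
  simp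

lemma isUniversal_of_mapCocone_dom (ζ : OplaxNormalCocone H s)
    (γ : ∀ x, (H.obj x).hom ≅ (ζ.app x).left ≫ s.hom) (hγ : ∀ x, (γ x).hom = (ζ.app x).cell)
    (hζ : (ζ.mapCocone (dom M)).IsUniversal) : ζ.IsUniversal := by
  intro U
  have hU : ((ζ.mapCocone (dom M)).postcomp U.left).IsIso := hζ U.left
  have hM : ((ζ.mapCocone (dom M)).postcomp M).IsIso := hζ M
  have (x : Groth W) : IsIso (ζ.app x).cell := by
    rw [← hγ]
    infer_instance
  -- Faithfulness at `M`: 2-cells out of `s.hom` are detected on the components of the cocone.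
  have cell_ext : ∀ {k : s.left ⟶ M} (a b : s.hom ⟶ k),
      (∀ x, (ζ.app x).left ◁ a = (ζ.app x).left ◁ b) → a = b := by
    intro k a b hab
    exact ((ζ.mapCocone (dom M)).postcomp M).map_injective (OplaxNormalCocone.hom_ext hab)
  refine { faithful := ⟨?_⟩, full := ⟨?_⟩, bijective_obj := ⟨?_, ?_⟩ }
  · intro h k a b hab
    apply hom₂_ext
    apply ((ζ.mapCocone (dom M)).postcomp U.left).map_injective
    exact OplaxNormalCocone.hom_ext fun x =>
      congrArg (fun m => Hom₂.left (OplaxNormalCocone.Hom.app m x)) hab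
  · intro h k m
    obtain ⟨δ, hδ⟩ := hU.full.map_surjective
      (X := h.left) (Y := k.left)
      (eqToHom (mapCocone_dom_postcompObj ζ h).symm ≫ domHom m ≫
        eqToHom (mapCocone_dom_postcompObj ζ k))
    have hδx : ∀ x, (ζ.app x).left ◁ δ = (OplaxNormalCocone.Hom.app m x).left := by
      intro x
      have := congrArg (fun m => OplaxNormalCocone.Hom.app m x) hδ
      refine this.trans ?_
      refine (eqToHom_comp_comp_eqToHom_app _ _ _ x).trans ?_
      -- The two cocone equalities hold definitionally on components, so their `eqToHom`s are
      -- identities there.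
      exact (Category.id_comp _).trans (Category.comp_id _)
    refine ⟨⟨δ, cell_ext _ _ fun x => ?_⟩, OplaxNormalCocone.hom_ext fun x => hom₂_ext (hδx x)⟩
    refine whiskerLeft_cell_eq (γ := (ζ.app x).cell) ?_
    rw [hδx]
    exact (OplaxNormalCocone.Hom.app m x).w
  · intro h k hk
    have hl : h.left = k.left := by
      apply hU.bijective_obj.1
      change (ζ.mapCocone (dom M)).postcompObj h.left = (ζ.mapCocone (dom M)).postcompObj k.left
      rw [← mapCocone_dom_postcompObj, ← mapCocone_dom_postcompObj]
      exact congrArg (fun τ => mapCocone τ (dom M)) hk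
    obtain ⟨l, a⟩ := h
    obtain ⟨l', b⟩ := k
    obtain rfl : l = l' := hl
    refine congrArg (LaxSlice.Hom.mk l) (cell_ext _ _ fun x => ?_)
    have hx := congrArg (fun τ => OplaxNormalCocone.app τ x) hk
    change (⟨(ζ.app x).left ≫ l, (ζ.app x).cell ≫ (ζ.app x).left ◁ a ≫
      (α_ (ζ.app x).left l U.hom).inv⟩ : LaxSlice.Hom _ _) =
      ⟨(ζ.app x).left ≫ l, (ζ.app x).cell ≫ (ζ.app x).left ◁ b ≫
      (α_ (ζ.app x).left l U.hom).inv⟩ at hx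
    have hx' : (ζ.app x).cell ≫ (ζ.app x).left ◁ a ≫ (α_ (ζ.app x).left l U.hom).inv =
        (ζ.app x).cell ≫ (ζ.app x).left ◁ b ≫ (α_ (ζ.app x).left l U.hom).inv := by
      injection hx
    rwa [cancel_epi, cancel_mono] at hx'
  · intro σ
    obtain ⟨(h : s.left ⟶ U.left), hh⟩ := hU.bijective_obj.2 (σ.mapCocone (dom M))
    -- The equality of cocones is kept as a modification, so that the fillers of `σ` need no
    -- transport.
    let m : σ.mapCocone (dom M) ⟶ (ζ.mapCocone (dom M)).postcompObj h := eqToHom hh.symm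
    obtain ⟨c, hc⟩ := hM.full.map_surjective
      (X := s.hom) (Y := h ≫ U.hom) (cellHom ζ γ hγ σ h m)
    have hcx : ∀ x, (ζ.app x).left ◁ c = (γ x).inv ≫ (σ.app x).cell ≫
        OplaxNormalCocone.Hom.app m x ▷ U.hom ≫ (α_ (ζ.app x).left h U.hom).hom :=
      fun x => congrArg (fun m => OplaxNormalCocone.Hom.app m x) hc
    let t : s ⟶ U := ⟨h, c⟩
    let n : σ ⟶ ζ.postcompObj t :=
      { app := fun x => ⟨OplaxNormalCocone.Hom.app m x, by
          change _ = (ζ.app x).cell ≫ (ζ.app x).left ◁ c ≫ (α_ (ζ.app x).left h U.hom).inv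
          rw [hcx, ← hγ]
          exact (cell_reassoc (γ x) _ _).symm⟩
        naturality := fun {x y} f => hom₂_ext (by
          have := m.naturality f
          rw [mapCocone_dom_nat] at this
          refine this.trans ?_
          exact congrArg (fun k => OplaxNormalCocone.Hom.app m x ≫ k ▷ h ≫
            (α_ (H.map f).left (ζ.app y).left h).hom) (mapCocone_dom_nat ζ f)) }
    have hl : ∀ x, (σ.app x).left = (ζ.app x).left ≫ h :=
      fun x => congrArg (fun τ => OplaxNormalCocone.app τ x) hh.symm
    have hnl : ∀ x, (OplaxNormalCocone.Hom.app n x).left = eqToHom (hl x) :=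
      fun x => OplaxNormalCocone.eqToHom_app hh.symm x
    have hn : ∀ x, σ.app x = (ζ.postcompObj t).app x :=
      fun x => hom_eq (OplaxNormalCocone.Hom.app n x) (hl x) (hnl x)
    -- `n` lies over `m`, whose components are `eqToHom`s, and a modification of this kind forces
    -- equality in the slice.
    refine ⟨t, (eq_of_hom n hn fun x => hom₂_ext ?_).symm⟩
    rw [eqToHom_left]
    exact hnl x

end Universal
end LaxSlice
end TwoColim

/-! ### Construction and uniqueness of liftings to the lax slice. -/

namespace TwoColim
namespace LaxSlice

variable {E : Type u} [Bicategory.{w, v} E] [Strict E] {M : E}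
variable {A : Type u₁} [Bicategory.{w₁, v₁} A] {W : StrictPseudofunctor Aᵒᵖ Cat.{v₂, u₂}}

open OplaxNormalCocone

section Lifting

/-- Uniqueness of the lifted diagram: since `γy` is invertible, the compatibility equation can be
solved for `k`. -/
lemma eq_of_whiskerRight_eq {a b c : E} {F : a ⟶ b} {tx : a ⟶ c} {ty : b ⟶ c} {q : c ⟶ M}
    {gx : a ⟶ M} {gy : b ⟶ M} (γx : gx ≅ tx ≫ q) (γy : gy ≅ ty ≫ q) {t : tx ⟶ F ≫ ty}
    {k : gx ⟶ F ≫ gy} (h : γx.hom ≫ t ▷ q = k ≫ F ◁ γy.hom ≫ (α_ F ty q).inv) :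
    k = γx.hom ≫ t ▷ q ≫ (α_ F ty q).hom ≫ F ◁ γy.inv := by
  rw [reassoc_of% h]
  simp

lemma isUniversal_of_sigma_eq {D D' : StrictPseudofunctor (Groth W) E} {C : E}
    {θ : OplaxNormalCocone D C} {θ' : OplaxNormalCocone D' C}
    (h : (⟨D', θ'⟩ : Σ D : StrictPseudofunctor (Groth W) E, OplaxNormalCocone D C) = ⟨D, θ⟩)
    (hθ : θ.IsUniversal) : θ'.IsUniversal := by
  cases h
  exact hθ

variable {D : StrictPseudofunctor (Groth W) E} {C : E} (θ : OplaxNormalCocone D C) (q : C ⟶ M)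
  (g : ∀ x, D.obj x ⟶ M) (γ : ∀ x, g x ≅ θ.app x ≫ q)

/-- The 2-cell filling the image of `f` under the lifting of a diagram to the lax slice. -/
def liftCell {x y : Groth W} (f : x ⟶ y) : g x ⟶ D.map f ≫ g y :=
  (γ x).hom ≫ θ.nat f ▷ q ≫ (α_ (D.map f) (θ.app y) q).hom ≫ D.map f ◁ (γ y).inv

lemma liftCell_map₂ {x y : Groth W} {f f' : x ⟶ y} (δ : f ⟶ f') :
    liftCell θ q g γ f ≫ D.map₂ δ ▷ g y = liftCell θ q g γ f' := by
  simp [liftCell, ← θ.nat_map₂ δ, whisker_exchange]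

/-- Interchange, oriented to carry the unit and composition cells of `D` past the inverse fillers.
-/
lemma whisker_app_inv {x y : Groth W} {k k' : D.obj x ⟶ D.obj y} (η : k ⟶ k') :
    η ▷ θ.app y ▷ q ≫ (α_ k' (θ.app y) q).hom ≫ k' ◁ (γ y).inv =
      (α_ k (θ.app y) q).hom ≫ k ◁ (γ y).inv ≫ η ▷ g y := by
  rw [whisker_exchange]
  simp

lemma liftCell_id (x : Groth W) :
    (λ_ (g x)).inv ≫ (D.mapId x).inv ▷ g x = liftCell θ q g γ (𝟙 x) := by
  simp [liftCell, θ.nat_id, whisker_app_inv]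

lemma liftCell_comp {x y z : Groth W} (f : x ⟶ y) (f' : y ⟶ z) :
    (liftCell θ q g γ f ≫ D.map f ◁ liftCell θ q g γ f' ≫ (α_ _ _ _).inv) ≫
      (D.mapComp f f').inv ▷ g z = liftCell θ q g γ (f ≫ f') := by
  simp [liftCell, θ.nat_comp, whisker_app_inv]

lemma liftCell_app {x y : Groth W} (f : x ⟶ y) :
    (γ x).hom ≫ θ.nat f ▷ q =
      liftCell θ q g γ f ≫ D.map f ◁ (γ y).hom ≫ (α_ (D.map f) (θ.app y) q).inv := by
  simp [liftCell]

variable [Strict A]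

/-- The lifting of a diagram to the lax slice determined by a cocone `θ` under it, a 1-cell `q`
and 1-cells isomorphic to the composites of the components of `θ` with `q`. -/
def liftFunctor : StrictPseudofunctor (Groth W) (LaxSlice M) :=
  StrictPseudofunctor.mk''
    { obj := fun x => ⟨D.obj x, g x⟩
      map := fun f => ⟨D.map f, liftCell θ q g γ f⟩
      map₂ := fun δ => ⟨D.map₂ δ, liftCell_map₂ θ q g γ δ⟩
      map₂_id := fun f => hom₂_ext (D.map₂_id f)
      map₂_comp := fun η κ => hom₂_ext (D.map₂_comp η κ)
      map_id := fun x => (hom_eq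
        (f := 𝟙 (⟨D.obj x, g x⟩ : LaxSlice M)) (g := ⟨D.map (𝟙 x), liftCell θ q g γ (𝟙 x)⟩)
        ⟨(D.mapId x).inv, liftCell_id θ q g γ x⟩ (D.map_id x).symm
        (congrArg Iso.inv (D.mapId_eq_eqToIso x))).symm
      map_comp := fun {x y z} f f' => (hom_eq
        (X := ⟨D.obj x, g x⟩) (Y := ⟨D.obj z, g z⟩)
        (f := Hom.mk (Y := ⟨D.obj y, g y⟩) (D.map f) (liftCell θ q g γ f) ≫
          Hom.mk (D.map f') (liftCell θ q g γ f'))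
        (g := ⟨D.map (f ≫ f'), liftCell θ q g γ (f ≫ f')⟩)
        ⟨(D.mapComp f f').inv, liftCell_comp θ q g γ f f'⟩
        (D.map_comp f f').symm
        (congrArg Iso.inv (D.mapComp_eq_eqToIso f f'))).symm
      map₂_whisker_left := fun f _ _ η => hom₂_ext (by
        rw [comp₂_left, comp₂_left, eqToHom_left, eqToHom_left]
        exact map₂_whiskerLeft_eq D f η)
      map₂_whisker_right := fun η h => hom₂_ext (by
        rw [comp₂_left, comp₂_left, eqToHom_left, eqToHom_left]
        exact map₂_whiskerRight_eq D η h) }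

lemma liftFunctor_mapId_inv_left (x : Groth W) :
    Hom₂.left ((liftFunctor θ q g γ).mapId x).inv = (D.mapId x).inv := by
  rw [StrictlyUnitaryPseudofunctor.mapId_eq_eqToIso, D.mapId_eq_eqToIso]
  exact eqToHom_left ((liftFunctor θ q g γ).map_id x).symm

lemma liftFunctor_mapComp_inv_left {x y z : Groth W} (f : x ⟶ y) (f' : y ⟶ z) :
    Hom₂.left ((liftFunctor θ q g γ).mapComp f f').inv = (D.mapComp f f').inv := by
  rw [StrictPseudofunctor.mapComp_eq_eqToIso, D.mapComp_eq_eqToIso]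
  exact eqToHom_left ((liftFunctor θ q g γ).map_comp f f').symm

/-- The lifting of the cocone `θ` to a cocone on `q` for the lifted diagram. -/
def liftCocone : OplaxNormalCocone (liftFunctor θ q g γ) (⟨C, q⟩ : LaxSlice M) where
  app x := ⟨θ.app x, (γ x).hom⟩
  nat f := ⟨θ.nat f, liftCell_app θ q g γ f⟩
  nat_id x := hom₂_ext ((θ.nat_id x).trans
    (congrArg (fun t => (λ_ (θ.app x)).inv ≫ t ▷ θ.app x)
      (liftFunctor_mapId_inv_left θ q g γ x).symm))
  nat_comp {x y z} f f' := hom₂_ext ((θ.nat_comp f f').trans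
    (congrArg (fun t => θ.nat f ≫ D.map f ◁ θ.nat f' ≫
      (α_ (D.map f) (D.map f') (θ.app z)).inv ≫ t ▷ θ.app z)
      (liftFunctor_mapComp_inv_left θ q g γ f f').symm))
  nat_map₂ δ := hom₂_ext (θ.nat_map₂ δ)
  normal {a b} f X := by
    obtain ⟨h, hh⟩ := θ.normal f X
    let F := liftFunctor θ q g γ
    let t (x : Groth W) : F.obj x ⟶ ⟨C, q⟩ := ⟨θ.app x, (γ x).hom⟩
    have h' : t _ = F.map (Groth.cart f X) ≫ t _ :=
      hom_eq ⟨θ.nat (Groth.cart f X), liftCell_app θ q g γ (Groth.cart f X)⟩ h hh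
    exact ⟨h', hom₂_ext (hh.trans (eqToHom_left h').symm)⟩

lemma liftCocone_lies_over :
    (⟨(liftFunctor θ q g γ).comp (dom M), (liftCocone θ q g γ).mapCocone (dom M)⟩ :
      Σ D : StrictPseudofunctor (Groth W) E, OplaxNormalCocone D C) = ⟨D, θ⟩ :=
  sigma_ext (fun _ => rfl) (fun _ => HEq.rfl) (fun _ => HEq.rfl) (fun _ => HEq.rfl)
    fun f => heq_of_eq (mapCocone_dom_nat (liftCocone θ q g γ) f)

lemma liftCocone_isUniversal (hθ : θ.IsUniversal) : (liftCocone θ q g γ).IsUniversal :=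
  isUniversal_of_mapCocone_dom _ γ (fun _ => rfl)
    (isUniversal_of_sigma_eq (liftCocone_lies_over θ q g γ) hθ)

/-- A cocone in the lax slice whose components have invertible filling 2-cells is the lifting of
its image. -/
lemma eq_liftCocone {H : StrictPseudofunctor (Groth W) (LaxSlice M)} {s : LaxSlice M}
    (ζ : OplaxNormalCocone H s)
    (γ : ∀ x, (H.obj x).hom ≅ (ζ.app x).left ≫ s.hom) (hγ : ∀ x, (γ x).hom = (ζ.app x).cell) :
    (⟨H, ζ⟩ : Σ H : StrictPseudofunctor (Groth W) (LaxSlice M), OplaxNormalCocone H s) =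
      ⟨liftFunctor (ζ.mapCocone (dom M)) s.hom (fun x => (H.obj x).hom) γ,
        liftCocone (ζ.mapCocone (dom M)) s.hom (fun x => (H.obj x).hom) γ⟩ := by
  have hmap : ∀ {x y : Groth W} (f : x ⟶ y), H.map f =
      (liftFunctor (ζ.mapCocone (dom M)) s.hom (fun x => (H.obj x).hom) γ).map f := by
    intro x y f
    refine congrArg (Hom.mk (H.map f).left) ?_
    have h := (ζ.nat f).w
    rw [LaxSlice.comp_cell, ← hγ, ← hγ] at h
    exact (eq_of_whiskerRight_eq (γ x) (γ y) h).trans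
      (congrArg (fun t => (γ x).hom ≫ t ▷ s.hom ≫ (α_ (H.map f).left (ζ.app y).left s.hom).hom ≫
        (H.map f).left ◁ (γ y).inv) (mapCocone_dom_nat ζ f).symm)
  have happ : ∀ x, ζ.app x =
      (liftCocone (ζ.mapCocone (dom M)) s.hom (fun x => (H.obj x).hom) γ).app x :=
    fun x => congrArg (Hom.mk (ζ.app x).left) (hγ x).symm
  refine sigma_ext (fun _ => rfl) (fun f => heq_of_eq (hmap f))
    (fun {x y f g} η => hom₂_heq (hmap f) (hmap g) HEq.rfl) (fun x => heq_of_eq (happ x))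
    fun {x y} f => ?_
  refine hom₂_heq (happ x) ?_ (heq_of_eq (mapCocone_dom_nat ζ f).symm)
  exact congrArg₂ (fun (a : H.obj x ⟶ H.obj y) (b : H.obj y ⟶ s) => a ≫ b) (hmap f) (happ y)

end Lifting
end LaxSlice
end TwoColim

/-! ### Liftings for an arbitrary cleavage and for the canonical one. -/

namespace TwoColim
namespace LaxSlice

variable {E : Type u} [Bicategory.{w, v} E] [Strict E] {M : E}
variable {A : Type u₁} [Bicategory.{w₁, v₁} A] {W : StrictPseudofunctor Aᵒᵖ Cat.{v₂, u₂}}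

open OplaxNormalCocone

section Cleavage

/-- Unpacks the choice made by a cleavage. Heterogeneous equality appears because the source of `γ`
is only propositionally `Y.hom`. -/
lemma exists_cell_eq {s Y : LaxSlice M} {φ : Y ⟶ s} {g : Y.left ⟶ M} {γ : g ≅ φ.left ≫ s.hom}
    (h : (⟨Y, φ⟩ : Σ Y : LaxSlice M, Y ⟶ s) = ⟨⟨Y.left, g⟩, ⟨φ.left, γ.hom⟩⟩) :
    ∃ γ' : Y.hom ≅ φ.left ≫ s.hom, γ'.hom = φ.cell ∧ g = Y.hom ∧ γ ≍ γ' := by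
  obtain ⟨l, k⟩ := Y
  obtain ⟨t, c⟩ := φ
  dsimp at g γ h
  obtain ⟨h₁, h₂⟩ := Sigma.mk.inj h
  obtain rfl : k = g := by injection h₁
  have h₃ := eq_of_heq h₂
  exact ⟨γ, by injection h₃ with _ h₄; exact h₄.symm, rfl, HEq.rfl⟩

variable [Strict A] {D : StrictPseudofunctor (Groth W) E} {s : LaxSlice M}
  {θ : OplaxNormalCocone D s.left} {g : ∀ x, D.obj x ⟶ M} {γ : ∀ x, g x ≅ θ.app x ≫ s.hom}
  {c : Cleavage (dom M)}

lemma liftCocone_isLifting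
    (hc : ∀ x, c.lift (s := s) (θ.app x) = ⟨⟨D.obj x, g x⟩, ⟨θ.app x, (γ x).hom⟩⟩) :
    c.IsLifting (s := s) θ (liftFunctor θ s.hom g γ) (liftCocone θ s.hom g γ) where
  lies_over := liftCocone_lies_over θ s.hom g γ
  chosen x := (hc x).symm

lemma eq_liftCocone_of_isLifting
    (hc : ∀ x, c.lift (s := s) (θ.app x) = ⟨⟨D.obj x, g x⟩, ⟨θ.app x, (γ x).hom⟩⟩)
    {H : StrictPseudofunctor (Groth W) (LaxSlice M)} {ζ : OplaxNormalCocone H s}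
    (h : c.IsLifting (s := s) θ H ζ) :
    (⟨H, ζ⟩ : Σ H : StrictPseudofunctor (Groth W) (LaxSlice M), OplaxNormalCocone H s) =
      ⟨liftFunctor θ s.hom g γ, liftCocone θ s.hom g γ⟩ := by
  obtain ⟨lo, ch⟩ := h
  -- Substitutes the image of `(H, ζ)` for `(D, θ)`, so that chosen components are compared without
  -- transport.
  cases lo
  have key : ∀ x, ∃ γ' : (H.obj x).hom ≅ (ζ.app x).left ≫ s.hom, γ'.hom = (ζ.app x).cell ∧
      g x = (H.obj x).hom ∧ γ x ≍ γ' :=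
    fun x => exists_cell_eq ((ch x).trans (hc x))
  choose γ' h₁ h₂ h₃ using key
  obtain rfl : g = fun x => (H.obj x).hom := funext h₂
  obtain rfl : γ = γ' := funext fun x => eq_of_heq (h₃ x)
  exact eq_liftCocone ζ γ h₁

variable (M) in
lemma dom_isTwoColimFibration (c : Cleavage (dom M)) :
    IsTwoColimFibration.{w, v, u, w₁, v₁, u₁, v₂, u₂} (dom M) c where
  locallyDiscreteOpfibration := dom_locallyDiscreteOpfibration
  lifting s A _ _ W D θ hθ := by
    choose g γ hc using fun x => exists_cleavage_lift_eq c s (θ.app x)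
    refine ⟨⟨_, liftCocone_isLifting hc, fun L hL => eq_liftCocone_of_isLifting hc hL⟩, ?_⟩
    intro H ζ h
    exact isUniversal_of_sigma_eq (eq_liftCocone_of_isLifting hc h)
      (liftCocone_isUniversal θ s.hom g γ hθ)

/-- Identity fillers are those of the canonical cleavage; conjugating by them does nothing. -/
lemma liftFunctor_refl {C : E} (θ : OplaxNormalCocone D C) (q : C ⟶ M) :
    liftFunctor θ q (fun x => θ.app x ≫ q) (fun _ => Iso.refl _) =
      (θ.postcompObj q).toLaxSlice := by
  have hmap : ∀ {x y : Groth W} (f : x ⟶ y),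
      (liftFunctor θ q (fun x => θ.app x ≫ q) (fun _ => Iso.refl _)).map f =
        (θ.postcompObj q).toLaxSlice.map f := by
    intro x y f
    refine congrArg
      (Hom.mk (X := ⟨D.obj x, θ.app x ≫ q⟩) (Y := ⟨D.obj y, θ.app y ≫ q⟩) (D.map f)) ?_
    change liftCell θ q (fun x => θ.app x ≫ q) (fun _ => Iso.refl _) f =
      θ.nat f ▷ q ≫ (α_ (D.map f) (θ.app y) q).hom
    simp [liftCell]
  exact strictPseudofunctor_ext (fun _ => rfl) (fun f => heq_of_eq (hmap f))
    fun {x y f g} η => hom₂_heq (hmap f) (hmap g) HEq.rfl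

lemma exists_lifting_toLaxSlice {C : E} (θ : OplaxNormalCocone D C) (hθ : θ.IsUniversal)
    (q : C ⟶ M) :
    ∃ ζ : OplaxNormalCocone (θ.postcompObj q).toLaxSlice (⟨C, q⟩ : LaxSlice M),
      ζ.IsUniversal ∧ ∀ c : Cleavage (dom M), IsCanonicalCleavage c →
        c.IsLifting (s := ⟨C, q⟩) θ _ ζ := by
  rw [← liftFunctor_refl]
  exact ⟨liftCocone θ q _ _, liftCocone_isUniversal θ q _ _ hθ,
    fun c hc => liftCocone_isLifting (s := ⟨C, q⟩) fun x => hc ⟨C, q⟩ (θ.app x)⟩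

end Cleavage
end LaxSlice
end TwoColim

/-! ### Normal cocones as weighted cocylinders. -/

namespace TwoColim

section Vertical

variable {A : Type u₁} [Bicategory.{w₁, v₁} A] {W : StrictPseudofunctor Aᵒᵖ Cat.{v₂, u₂}}

namespace Groth

/-- The vertical 1-cell of the Grothendieck construction given by a morphism of a fiber. -/
def vert {a : A} {X Y : W.obj (op a)} (α : X ⟶ Y) : (⟨a, X⟩ : Groth W) ⟶ ⟨a, Y⟩ :=
  ⟨𝟙 a, α ≫ (W.mapId (op a)).inv.toNatTrans.app Y⟩

/-- The 1-cell `(f, α)` with specified source and target. -/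
def homMk {a b : A} (f : a ⟶ b) {X : W.obj (op a)} {Y : W.obj (op b)}
    (α : X ⟶ (W.map f.op).toFunctor.obj Y) : (⟨a, X⟩ : Groth W) ⟶ ⟨b, Y⟩ :=
  ⟨f, α⟩

/-- The 2-cell from the composite of a vertical 1-cell with `(f, β)`. -/
def vertComp {a b : A} (f : a ⟶ b) {X X' : W.obj (op a)} {Y : W.obj (op b)} (α : X ⟶ X')
    (β : X' ⟶ (W.map f.op).toFunctor.obj Y) : vert α ≫ homMk f β ⟶ homMk f (α ≫ β) :=
  ⟨(λ_ f).hom, by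
    have e : op2 (λ_ f).hom = (ρ_ f.op).hom := rfl
    have n := (W.mapId (op a)).inv.toNatTrans.naturality β
    rw [comp_fiber]
    change ((α ≫ (W.mapId (op a)).inv.toNatTrans.app X') ≫ (W.map (𝟙 a).op).toFunctor.map β ≫
      (W.mapComp f.op (𝟙 a).op).inv.toNatTrans.app Y) ≫
        (W.map₂ (op2 (λ_ f).hom)).toNatTrans.app Y = α ≫ β
    rw [e, W.map₂_right_unitor]
    simp at n ⊢⟩

/-- The 2-cell from the composite of `(f, id)` with a vertical 1-cell. -/
def cartVert {a b : A} (f : a ⟶ b) {X Y : W.obj (op b)} (α : X ⟶ Y) :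
    cart f X ≫ vert α ⟶ homMk f ((W.map f.op).toFunctor.map α) :=
  ⟨(ρ_ f).hom, by
    have e : op2 (ρ_ f).hom = (λ_ f.op).hom := rfl
    rw [comp_fiber]
    change (𝟙 _ ≫ (W.map f.op).toFunctor.map (α ≫ (W.mapId (op b)).inv.toNatTrans.app Y) ≫
      (W.mapComp (𝟙 b).op f.op).inv.toNatTrans.app Y) ≫
        (W.map₂ (op2 (ρ_ f).hom)).toNatTrans.app Y = (W.map f.op).toFunctor.map α
    rw [e, W.map₂_left_unitor]
    simp [← Functor.map_comp]⟩

end Groth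

end Vertical

section StrictCells

variable {E : Type u} [Bicategory.{w, v} E] [Strict E] {a b c : E}

/-- Here `k` stands for `F.map (𝟙 a)`; as a variable it can be replaced by the identity, after which
only strict coherence cells remain. The next two lemmas use the same device. -/
lemma vert_comp_cell {k : a ⟶ a} (hk : k = 𝟙 a) {f g : a ⟶ b} {p : b ⟶ c} {x y : a ⟶ c}
    (n : x ⟶ k ≫ y) (m : y ⟶ f ≫ p) (h : k ≫ f = g) (h' : g = f) (e : k ≫ y = y) :
    (n ≫ k ◁ m ≫ (α_ k f p).inv ≫ eqToHom h ▷ p) ≫ eqToHom h' ▷ p = (n ≫ eqToHom e) ≫ m := by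
  subst hk h
  simp [Strict.associator_eqToIso, Strict.leftUnitor_eqToIso]

lemma comp_vert_cell {k : b ⟶ b} (hk : k = 𝟙 b) {f g : a ⟶ b} {p q : b ⟶ c} {x : a ⟶ c}
    (n : x ⟶ f ≫ q) (m : q ⟶ k ≫ p) (h : f ≫ k = g) (h' : g = f) (e : k ≫ p = p) :
    (n ≫ f ◁ m ≫ (α_ f k p).inv ≫ eqToHom h ▷ p) ≫ eqToHom h' ▷ p =
      n ≫ f ◁ (m ≫ eqToHom e) := by
  subst hk h
  simp [Strict.associator_eqToIso]

lemma vert_naturality_cell {k : a ⟶ a} (hk : k = 𝟙 a) {x y x' y' : a ⟶ c} {n : x ⟶ k ≫ y}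
    {n' : x' ⟶ k ≫ y'} {t : y ⟶ y'} {s : x ⟶ x'} (h : n ≫ k ◁ t = s ≫ n')
    (e : k ≫ y = y) (e' : k ≫ y' = y') :
    (n ≫ eqToHom e) ≫ t = s ≫ n' ≫ eqToHom e' := by
  subst hk
  rw [← reassoc_of% h]
  simp [Strict.leftUnitor_eqToIso]

end StrictCells

namespace OplaxNormalCocone

variable {E : Type u} [Bicategory.{w, v} E] [Strict E]
variable {A : Type u₁} [Bicategory.{w₁, v₁} A] [Strict A]
  {W : StrictPseudofunctor Aᵒᵖ Cat.{v₂, u₂}} {F : StrictPseudofunctor A E} {C : E}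

lemma map_id_comp {A : Type u₁} [Bicategory.{w₁, v₁} A] (F : StrictPseudofunctor A E) {a : A}
    (x : F.obj a ⟶ C) : F.map (𝟙 a) ≫ x = x := by
  rw [F.map_id]
  exact Strict.id_comp x

/-- The components of a cocone on a fiber. -/
def fiberApp (σ : OplaxNormalCocone ((Groth.proj W).comp F) C) {a : A} (X : W.obj (op a)) :
    F.obj a ⟶ C :=
  σ.app ⟨a, X⟩

/-- The structure 2-cell of a cocone at the 1-cell `(f, α)`. -/
def fiberNat (σ : OplaxNormalCocone ((Groth.proj W).comp F) C) {a b : A} (f : a ⟶ b)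
    {X : W.obj (op a)} {Y : W.obj (op b)} (α : X ⟶ (W.map f.op).toFunctor.obj Y) :
    σ.fiberApp X ⟶ F.map f ≫ σ.fiberApp Y :=
  σ.nat (Groth.homMk f α)

/-- The action of a cocone on the morphisms of a fiber. -/
def fiberMap (σ : OplaxNormalCocone ((Groth.proj W).comp F) C) {a : A} {X Y : W.obj (op a)}
    (α : X ⟶ Y) : σ.fiberApp X ⟶ σ.fiberApp Y :=
  σ.fiberNat (𝟙 a) (α ≫ (W.mapId (op a)).inv.toNatTrans.app Y) ≫
    eqToHom (map_id_comp F (σ.fiberApp Y))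

lemma fiberNat_vert_comp (σ : OplaxNormalCocone ((Groth.proj W).comp F) C) {a b : A} (f : a ⟶ b)
    {X X' : W.obj (op a)} {Y : W.obj (op b)} (α : X ⟶ X')
    (β : X' ⟶ (W.map f.op).toFunctor.obj Y) :
    σ.fiberNat f (α ≫ β) = σ.fiberMap α ≫ σ.fiberNat f β := by
  refine (σ.nat_map₂ (Groth.vertComp f α β)).symm.trans ?_
  rw [σ.nat_comp]
  have h₁ : (((Groth.proj W).comp F).mapComp (Groth.vert α) (Groth.homMk f β)).inv =
      eqToHom (F.map_comp (𝟙 a) f).symm := by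
    rw [StrictPseudofunctor.mapComp_eq_eqToIso]; rfl
  have h₂ : ((Groth.proj W).comp F).map₂ (Groth.vertComp f α β) =
      eqToHom (congrArg F.map (Strict.id_comp f)) := by
    change F.map₂ (λ_ f).hom = _
    rw [Strict.leftUnitor_eqToIso, eqToIso.hom, PrelaxFunctor.map₂_eqToHom]
  rw [h₁, h₂]
  exact vert_comp_cell (F.map_id a) _ _ _ _ _

/-- Factors `(f, W(f)(α))` with the vertical part last. Comparison with the factorization that has
it first yields naturality of the fiber functors in `f`. -/
lemma fiberNat_cart_comp (σ : OplaxNormalCocone ((Groth.proj W).comp F) C) {a b : A} (f : a ⟶ b)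
    {X Y : W.obj (op b)} (α : X ⟶ Y) :
    σ.fiberNat f ((W.map f.op).toFunctor.map α) =
      σ.fiberNat f (𝟙 ((W.map f.op).toFunctor.obj X)) ≫ F.map f ◁ σ.fiberMap α := by
  refine (σ.nat_map₂ (Groth.cartVert f α)).symm.trans ?_
  rw [σ.nat_comp]
  have h₁ : (((Groth.proj W).comp F).mapComp (Groth.cart f X) (Groth.vert α)).inv =
      eqToHom (F.map_comp f (𝟙 b)).symm := by
    rw [StrictPseudofunctor.mapComp_eq_eqToIso]; rfl
  have h₂ : ((Groth.proj W).comp F).map₂ (Groth.cartVert f α) =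
      eqToHom (congrArg F.map (Strict.comp_id f)) := by
    change F.map₂ (ρ_ f).hom = _
    rw [Strict.rightUnitor_eqToIso, eqToIso.hom, PrelaxFunctor.map₂_eqToHom]
  rw [h₁, h₂]
  exact comp_vert_cell (F.map_id b) _ _ _ _ _

lemma fiberApp_map (σ : OplaxNormalCocone ((Groth.proj W).comp F) C) {a b : A} (f : a ⟶ b)
    (X : W.obj (op b)) :
    σ.fiberApp ((W.map f.op).toFunctor.obj X) = F.map f ≫ σ.fiberApp X :=
  (σ.normal f X).1

lemma fiberNat_id (σ : OplaxNormalCocone ((Groth.proj W).comp F) C) {a b : A} (f : a ⟶ b)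
    (X : W.obj (op b)) :
    σ.fiberNat f (𝟙 ((W.map f.op).toFunctor.obj X)) = eqToHom (σ.fiberApp_map f X) :=
  (σ.normal f X).2

/-- This is where normality enters: the factor at `(f, id)` is an equality, so a cocone is
determined by its values on fibers. -/
lemma fiberNat_eq (σ : OplaxNormalCocone ((Groth.proj W).comp F) C) {a b : A} (f : a ⟶ b)
    {X : W.obj (op a)} {Y : W.obj (op b)} (α : X ⟶ (W.map f.op).toFunctor.obj Y) :
    σ.fiberNat f α = σ.fiberMap α ≫ eqToHom (σ.fiberApp_map f Y) := by
  rw [← fiberNat_id, ← fiberNat_vert_comp, Category.comp_id]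

lemma fiberMap_id (σ : OplaxNormalCocone ((Groth.proj W).comp F) C) {a : A}
    (X : W.obj (op a)) : σ.fiberMap (𝟙 X) = 𝟙 _ := by
  have h : σ.fiberNat (𝟙 a) ((W.mapId (op a)).inv.toNatTrans.app X) =
      (λ_ (σ.fiberApp X)).inv ≫ eqToHom (F.map_id a).symm ▷ σ.fiberApp X := by
    refine (σ.nat_id ⟨a, X⟩).trans ?_
    rw [StrictlyUnitaryPseudofunctor.mapId_eq_eqToIso]
    rfl
  rw [fiberMap, Category.id_comp, h, Strict.leftUnitor_eqToIso, eqToHom_whiskerRight]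
  simp

lemma fiberMap_comp (σ : OplaxNormalCocone ((Groth.proj W).comp F) C) {a : A}
    {X Y Z : W.obj (op a)} (α : X ⟶ Y) (β : Y ⟶ Z) :
    σ.fiberMap (α ≫ β) = σ.fiberMap α ≫ σ.fiberMap β := by
  rw [fiberMap, Category.assoc, fiberNat_vert_comp]
  exact Category.assoc _ _ _

lemma fiberMap_naturality {σ τ : OplaxNormalCocone ((Groth.proj W).comp F) C} (m : σ ⟶ τ)
    {a : A} {X Y : W.obj (op a)} (α : X ⟶ Y) {s : σ.fiberApp X ⟶ τ.fiberApp X}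
    {t : σ.fiberApp Y ⟶ τ.fiberApp Y} (hs : s = m.app ⟨a, X⟩) (ht : t = m.app ⟨a, Y⟩) :
    σ.fiberMap α ≫ t = s ≫ τ.fiberMap α := by
  subst hs ht
  exact vert_naturality_cell (F.map_id a) (m.naturality (Groth.vert α)) _ _

/-- The weighted 2-cocylinder that corresponds to an oplax normal 2-cocone. -/
def toCocylinder (σ : OplaxNormalCocone ((Groth.proj W).comp F) C) : Cocylinder W F C where
  app a :=
    { obj := fun X => σ.fiberApp X
      map := fun α => σ.fiberMap α
      map_id := fun X => σ.fiberMap_id X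
      map_comp := fun α β => σ.fiberMap_comp α β }
  naturality_obj f X := σ.fiberApp_map f X
  naturality_map {a b} f X Y α := by
    dsimp only
    rw [← fiberNat_eq, fiberNat_cart_comp, fiberNat_id]
  naturality₂ {a b f g} δ X := by
    dsimp only
    -- `δ` underlies a 2-cell from `(f, id)` to `(g, W(δ)_X)`; compatibility of `σ` with it is the
    -- required equation.
    let η : Groth.cart f X ⟶ Groth.homMk g ((W.map₂ (op2 δ)).toNatTrans.app X) :=
      ⟨δ, Category.id_comp _⟩
    rw [← fiberNat_eq, ← fiberNat_id]
    exact (σ.nat_map₂ η).symm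

lemma toCocone_toCocylinder (σ : OplaxNormalCocone ((Groth.proj W).comp F) C) :
    σ.toCocylinder.toCocone = σ :=
  eq_of_nat_heq (fun _ => rfl) fun f => heq_of_eq (σ.fiberNat_eq f.base f.fiber).symm

end OplaxNormalCocone

/-! ### Transfer of universality from cocylinders to cocones. -/

namespace Cocylinder

open OplaxNormalCocone

variable {E : Type u} [Bicategory.{w, v} E] [Strict E]
variable {A : Type u₁} [Bicategory.{w₁, v₁} A] [Strict A]
  {W : StrictPseudofunctor Aᵒᵖ Cat.{v₂, u₂}} {F : StrictPseudofunctor A E} {C : E}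

lemma toCocone_fiberMap (μ : Cocylinder W F C) {a : A} {X Y : W.obj (op a)} (α : X ⟶ Y) :
    μ.toCocone.fiberMap α = (μ.app a).map α := by
  change ((μ.app a).map (α ≫ (W.mapId (op a)).inv.toNatTrans.app Y) ≫
    eqToHom (μ.naturality_obj (𝟙 a) Y)) ≫ eqToHom (map_id_comp F ((μ.app a).obj Y)) = _
  rw [Functor.map_comp, app_map_mapId_inv]
  simp

lemma toCocone_nat_cart (μ : Cocylinder W F C) {a b : A} (f : a ⟶ b) (X : W.obj (op b)) :
    μ.toCocone.nat (Groth.cart f X) = eqToHom (μ.naturality_obj f X) :=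
  (congrArg (· ≫ eqToHom (μ.naturality_obj f X)) ((μ.app a).map_id _)).trans (Category.id_comp _)

/-- A modification of weighted 2-cocylinders from a modification of the corresponding cocones. -/
def homOfCoconeHom {μ ν : Cocylinder W F C} (m : μ.toCocone ⟶ ν.toCocone) : μ ⟶ ν where
  app a :=
    { app := fun X => OplaxNormalCocone.Hom.app m ⟨a, X⟩
      naturality := fun X Y α => by
        rw [← toCocone_fiberMap, ← toCocone_fiberMap]
        exact fiberMap_naturality m α rfl rfl }
  naturality {a b} f X := by
    have h := m.naturality (Groth.cart f X)
    rw [toCocone_nat_cart, toCocone_nat_cart] at h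
    exact h.symm

/-- An equality of cocones gives a modification of cocylinders with `eqToHom` components; its
naturality on fiber morphisms identifies the functors. -/
lemma toCocone_injective :
    Function.Injective (toCocone : Cocylinder W F C → _) := by
  intro μ ν h
  have hobj : ∀ a X, (μ.app a).obj X = (ν.app a).obj X := fun a X =>
    congrArg (fun τ => OplaxNormalCocone.app τ ⟨a, X⟩) h
  refine Cocylinder.ext (funext fun a => CategoryTheory.Functor.ext (hobj a) fun X Y α => ?_)
  have n := ((homOfCoconeHom (eqToHom h)).app a).naturality α
  have hX : ∀ X, ((homOfCoconeHom (eqToHom h)).app a).app X = eqToHom (hobj a X) :=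
    fun X => OplaxNormalCocone.eqToHom_app h ⟨a, X⟩
  rw [hX, hX] at n
  rw [← reassoc_of% n]
  simp

lemma toCocone_postcompObj (μ : Cocylinder W F C) {U : E} (h : C ⟶ U) :
    (μ.postcompObj h).toCocone = μ.toCocone.postcompObj h := by
  refine eq_of_nat_heq (fun _ => rfl) fun {x y} f => heq_of_eq ?_
  change (μ.app x.base).map f.fiber ▷ h ≫ eqToHom _ =
    ((μ.app x.base).map f.fiber ≫ eqToHom (μ.naturality_obj f.base y.fiber)) ▷ h ≫
      (α_ (F.map f.base) ((μ.app y.base).obj y.fiber) h).hom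
  simp [Strict.associator_eqToIso]

/-- Each requirement is transported along the correspondence: modifications through
`homOfCoconeHom`, objects through injectivity of `toCocone` and its section `toCocylinder`. -/
lemma toCocone_isUniversal (μ : Cocylinder W F C) (hμ : μ.IsUniversal) :
    μ.toCocone.IsUniversal := by
  intro U
  have hU := hμ U
  refine { faithful := ⟨?_⟩, full := ⟨?_⟩, bijective_obj := ⟨?_, ?_⟩ }
  · intro h k η κ e
    apply (μ.postcomp U).map_injective
    refine Cocylinder.hom_ext fun a => NatTrans.ext (funext fun X => ?_)
    exact congrArg (fun m => OplaxNormalCocone.Hom.app m ⟨a, X⟩) e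
  · intro h k m
    obtain ⟨η, hη⟩ := (μ.postcomp U).map_surjective (X := h) (Y := k) (homOfCoconeHom
      (eqToHom (μ.toCocone_postcompObj h) ≫ m ≫ eqToHom (μ.toCocone_postcompObj k).symm))
    refine ⟨η, OplaxNormalCocone.hom_ext fun x => ?_⟩
    have e := congrArg (fun n => (Cocylinder.Hom.app n x.base).app x.fiber) hη
    refine e.trans ((eqToHom_comp_comp_eqToHom_app _ _ _ x).trans ?_)
    exact (Category.id_comp _).trans (Category.comp_id _)
  · intro h k e
    apply hU.bijective_obj.1
    apply toCocone_injective
    exact (μ.toCocone_postcompObj h).trans (e.trans (μ.toCocone_postcompObj k).symm)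
  · intro σ
    obtain ⟨h, hh⟩ := hU.bijective_obj.2 σ.toCocylinder
    refine ⟨h, (μ.toCocone_postcompObj h).symm.trans ?_⟩
    exact (congrArg toCocone hh).trans σ.toCocone_toCocylinder

end Cocylinder
end TwoColim

theorem mainTheorem1 {E : Type u} [Bicategory.{w, v} E] [Strict E] (M : E) :
    (∃ c : Cleavage (LaxSlice.dom M), LaxSlice.IsCanonicalCleavage c) ∧
    (∀ c : Cleavage (LaxSlice.dom M),
      IsTwoColimFibration.{w, v, u, w₁, v₁, u₁, v₂, u₂} (LaxSlice.dom M) c) ∧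
    ∀ {A : Type u₁} [Bicategory.{w₁, v₁} A] [Strict A]
      (W : StrictPseudofunctor Aᵒᵖ Cat.{v₂, u₂}) (F : StrictPseudofunctor A E) (C : E)
      (μ : Cocylinder W F C), μ.IsUniversal → ∀ q : C ⟶ M,
        μ.toCocone.IsUniversal ∧
        ∃ ζ : OplaxNormalCocone ((μ.postcomp M).obj q).toCocone.toLaxSlice ⟨C, q⟩,
          ζ.IsUniversal ∧
          ∀ c : Cleavage (LaxSlice.dom M), LaxSlice.IsCanonicalCleavage c →
            c.IsLifting (s := ⟨C, q⟩) μ.toCocone _ ζ := by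
  refine ⟨⟨LaxSlice.canonicalCleavage M, fun _ _ _ => rfl⟩, LaxSlice.dom_isTwoColimFibration M, ?_⟩
  intro A _ _ W F C μ hμ q
  refine ⟨μ.toCocone_isUniversal hμ, ?_⟩
  -- The type of `ζ` depends on this cocone, so the diagram must be rewritten before the canonical
  -- lifting applies.
  have h : ((μ.postcomp M).obj q).toCocone = μ.toCocone.postcompObj q := μ.toCocone_postcompObj q
  rw [h]
  exact LaxSlice.exists_lifting_toLaxSlice μ.toCocone (μ.toCocone_isUniversal hμ) q
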